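/- Let $k\ge 1$ be an integer, let $\mathbf m$ be Lebesgue measure on $\mathbb R^k$, let $(\mathcal X,\mathbf d)$ be a compact metric space and let $T\colon\mathbb R^k\times\mathcal X\to\mathcal X$ be a continuous action. Logarithms are to base $2$. **Metrics.** For $A\subset\mathbb R^k$ and real $L>0$ put $$\mathbf d_A(x,y)=\sup_{u\in A}\mathbf d(T^ux,T^uy),\qquad \mathbf d_L=\mathbf d_{[0,L]^k},\qquad \bar{\mathbf d}_L(x,y)=\frac1{L^k}\int_{[0,L]^k}\mathbf d(T^ux,T^uy)\,d\mathbf m(u),$$ and for an integer $L\ge1$ put $$(\bar{\mathbf d}_1)^{\mathbb Z}_L(x,y)=\max_{u\in\{0,1,\dots,L-1\}^k}\bar{\mathbf d}_1(T^ux,T^uy).$$ For a metric $\rho$ on $\mathcal X$ write $\operatorname{diam}(A,\rho)=\sup_{x,y\in A}\rho(x,y)$ (with $\operatorname{diam}(\emptyset,\rho)=0$), and let $\#(\mathcal X,\rho,\varepsilon)$ be the minimum $n$ such that $\mathcal X$ is covered by $n$ open sets of $\rho$-diameter smaller than $\varepsilon$. The space $(\mathcal X,\rho)$ has the *tame growth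 of covering numbers* if $\lim_{\varepsilon\to0}\varepsilon^{\delta}\log\#(\mathcal X,\rho,\varepsilon)=0$ for every $\delta>0$. **Rate distortion dimension.** For random variables $X,Y$ with finitely many values let $I(X;Y)=H(X)+H(Y)-H(X,Y)$, where $H$ is Shannon entropy; in general let $I(X;Y)$ be the supremum of $I(f(X);g(Y))$ over measurable maps $f,g$ to finite sets. Let $\mu$ be a $T$-invariant Borel probability measure on $\mathcal X$. For $\varepsilon>0$ and a bounded Borel set $A\subset\mathbb R^k$ with $\mathbf m(A)>0$, let $L^1(A,\mathcal X)$ be the space of measurable maps $A\to\mathcal X$ modulo a.e. equality, with the Borel $\sigma$-algebra of the metric $\int_A\mathbf d(f(u),g(u))\,d\mathbf m(u)$, and let $R(\varepsilon,A)$ be the infimum of $I(X;Y)$ over all pairs of random variables $X,Y$ on a common probability space such that $X$ has law $\mu$, $Y$ takes values in $L^1(A,\mathcal X)$, and $$\mathbb E\Big(\frac1{\mathbf m(A)}\int_A\mathbf d(T^uX,Y_u)\,d\mathbf m(u)\Big)<\varepsilon .$$ Put $$R(\mathbf d,\mu,\varepsilon)=\lim_{L\to\infty}\frac{R(\varepsilon,[0,L)^k)}{L^k},\qquad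 \underline{\operatorname{rdim}}(\mathcal X,T,\mathbf d,\mu)=\liminf_{\varepsilon\to0}\frac{R(\mathbf d,\mu,\varepsilon)}{\log(1/\varepsilon)}\in[0,\infty]$$ (the limit in $L$ exists). **Proposition.** Suppose that $(\mathcal X,\bar{\mathbf d}_1)$ has the tame growth of covering numbers and that there exist $a\in\mathbb R^k$, $C>0$ and an integer $\ell\ge0$ such that $$\mathbf d_{a+[0,L]^k}(x,y)\le C\,(\bar{\mathbf d}_1)^{\mathbb Z}_{L+\ell}(x,y)$$ for all $x,y\in\mathcal X$ and all integers $L\ge1$. Let $L_n$, $M_n$ be sequences of positive real numbers with $L_n\to\infty$, let $\nu_n$ be a sequence of Borel probability measures on $\mathcal X$ (not necessarily invariant), and set $$\mu_n=\frac1{L_n^k}\int_{[0,L_n]^k}T^u_*\nu_n\,d\mathbf m(u).$$ Assume: 1. there exist $\delta>0$ and $C'>0$ such that, for every $n$, $$\nu_n(A)\le\big(C'\cdot\operatorname{diam}(A,\mathbf d_{L_n})\big)^{M_n}$$ for every Borel set $A\subset\mathcal X$ with $\operatorname{diam}(A,\mathbf d_{L_n})<\delta$; 2. $\mu_n$ converges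 in the weak$^*$ topology to a $T$-invariant Borel probability measure $\mu$ on $\mathcal X$. Then $$\underline{\operatorname{rdim}}(\mathcal X,T,\mathbf d,\mu)\ \ge\ \limsup_{n\to\infty}\frac{M_n}{L_n^k}$$ (as elements of $[0,\infty]$). -/

import Mathlib

open MeasureTheory Filter Topology Set
open scoped ENNReal

universe u

noncomputable section

namespace RateDistortion

/-! ### Metrics given as functions -/

section Metrics

variable {X : Type u}

/-- The diameter of `A` with respect to the (bounded) metric `ρ`. -/
def diamWrt (ρ : X → X → ℝ) (A : Set X) : ℝ :=
  sSup {r : ℝ | ∃ x ∈ A, ∃ y ∈ A, r = ρ x y}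

/-- `U` is open in the metric space `(X, ρ)`. -/
def IsOpenWrt (ρ : X → X → ℝ) (U : Set X) : Prop :=
  ∀ x ∈ U, ∃ r > 0, ∀ y, ρ x y < r → y ∈ U

/-- The `ε`-covering number of `(X, ρ)`: the minimum `n` such that `X` is a union of `n` open sets
of diameter smaller than `ε`. -/
def coveringNumber (ρ : X → X → ℝ) (ε : ℝ) : ℕ :=
  sInf {n : ℕ | ∃ U : Fin n → Set X,
    (∀ i, IsOpenWrt ρ (U i)) ∧ (∀ i, diamWrt ρ (U i) < ε) ∧ (⋃ i, U i) = univ}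

/-- Tame growth of covering numbers of the metric space `(X, ρ)`. -/
def TameGrowth (ρ : X → X → ℝ) : Prop :=
  ∀ δ : ℝ, 0 < δ →
    Tendsto (fun ε : ℝ => ε ^ δ * Real.logb 2 (coveringNumber ρ ε : ℝ)) (𝓝[>] 0) (𝓝 0)

end Metrics

/-- The closed cube `[0, L]^k` in `ℝ^k`. -/
def cube (k : ℕ) (L : ℝ) : Set (Fin k → ℝ) := Set.pi univ fun _ => Set.Icc 0 L

/-- The half-open cube `[0, L)^k` in `ℝ^k`. -/
def halfOpenCube (k : ℕ) (L : ℝ) : Set (Fin k → ℝ) := Set.pi univ fun _ => Set.Ico 0 L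

/-! ### Metrics attached to an action of `ℝ^k`; here `T^u x` is written `u +ᵥ x` -/

section Action

variable {k : ℕ} {X : Type u} [MetricSpace X] [AddAction (Fin k → ℝ) X]

/-- `d_A (x, y) = sup_{v ∈ A} d (T^v x, T^v y)`. -/
def supDist (A : Set (Fin k → ℝ)) (x y : X) : ℝ :=
  ⨆ v : A, dist ((v : Fin k → ℝ) +ᵥ x) ((v : Fin k → ℝ) +ᵥ y)

variable (k) in
/-- `d̄_L (x, y) = L^{-k} ∫_{[0,L]^k} d (T^v x, T^v y) dv`. -/
def avgDist (L : ℝ) (x y : X) : ℝ :=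
  (L ^ k)⁻¹ * ∫ v in cube k L, dist (v +ᵥ x) (v +ᵥ y)

variable (k) in
/-- `ρ^ℤ_L (x, y) = max_{v ∈ {0, …, L-1}^k} ρ (T^v x, T^v y)` for a metric `ρ` on `X`. -/
def latticeSupDist (ρ : X → X → ℝ) (L : ℕ) (x y : X) : ℝ :=
  ⨆ v : Fin k → Fin L,
    ρ ((fun i => ((v i : ℕ) : ℝ)) +ᵥ x : X) ((fun i => ((v i : ℕ) : ℝ)) +ᵥ y)

end Action

/-! ### Mutual information (logarithms are to base 2) -/

section MutualInformation

variable {Ω : Type*} [MeasurableSpace Ω]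

/-- Shannon entropy of a random variable with finitely many values
(with `0 log 0 = 0`, which holds for `Real.logb`). -/
def shannonEntropy (P : Measure Ω) {S : Type*} [Fintype S] (Z : Ω → S) : ℝ :=
  -∑ s : S, P.real (Z ⁻¹' {s}) * Real.logb 2 (P.real (Z ⁻¹' {s}))

/-- Mutual information of two random variables with finitely many values. -/
def finiteMutualInfo (P : Measure Ω) {S S' : Type*} [Fintype S] [Fintype S']
    (Z : Ω → S) (W : Ω → S') : ℝ :=
  shannonEntropy P Z + shannonEntropy P W - shannonEntropy P (fun ω => (Z ω, W ω))

/-- Mutual information of arbitrary random variables: the supremum of `I (f(Z); g(W))` over all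
measurable maps `f`, `g` to finite (discrete) sets. -/
def mutualInfo (P : Measure Ω) {E F : Type*} [MeasurableSpace E] [MeasurableSpace F]
    (Z : Ω → E) (W : Ω → F) : ℝ≥0∞ :=
  ⨆ (m : ℕ) (n : ℕ) (f : E → Fin m) (g : F → Fin n) (_ : Measurable f) (_ : Measurable g),
    ENNReal.ofReal (finiteMutualInfo P (fun ω => f (Z ω)) (fun ω => g (W ω)))

end MutualInformation

/-! ### The space `L¹(A, X)` -/

section L1

/-- Measurable maps `A → X` up to almost everywhere equality. -/
def L1Space {k : ℕ} (A : Set (Fin k → ℝ)) (X : Type u) [MetricSpace X] : Type u :=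
  (Fin k → ℝ) →ₘ[volume.restrict A] X

variable {k : ℕ} {A : Set (Fin k → ℝ)} {X : Type u} [MetricSpace X]

/-- A representative of an element of `L¹(A, X)`. -/
def L1Space.rep (f : L1Space A X) : (Fin k → ℝ) → X :=
  AEEqFun.cast (μ := volume.restrict A) f

theorem L1Space.aestronglyMeasurable_rep (f : L1Space A X) :
    AEStronglyMeasurable f.rep (volume.restrict A) :=
  AEEqFun.aestronglyMeasurable (μ := volume.restrict A) f

/-- The metric `D (f, g) = ∫_A d (f v, g v) dv` (finite when `X` is bounded and `A` has finite
measure). -/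
instance L1Space.instEMetricSpace : EMetricSpace (L1Space A X) where
  edist f g := ∫⁻ v in A, edist (f.rep v) (g.rep v)
  edist_self f := by simp
  edist_comm f g := by simp only [edist_comm]
  edist_triangle f g h := by
    calc ∫⁻ v in A, edist (f.rep v) (h.rep v)
        ≤ ∫⁻ v in A, (edist (f.rep v) (g.rep v) + edist (g.rep v) (h.rep v)) :=
          lintegral_mono fun v => edist_triangle _ _ _
      _ = _ := lintegral_add_left'
          (f.aestronglyMeasurable_rep.edist g.aestronglyMeasurable_rep) _
  eq_of_edist_eq_zero {f g} h := by
    have h' := (lintegral_eq_zero_iff'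
      (f.aestronglyMeasurable_rep.edist g.aestronglyMeasurable_rep)).1 h
    refine AEEqFun.ext (μ := volume.restrict A) ?_
    filter_upwards [h'] with v hv
    exact eq_of_edist_eq_zero hv

instance L1Space.instMeasurableSpace : MeasurableSpace (L1Space A X) := borel _

instance L1Space.instBorelSpace : BorelSpace (L1Space A X) := ⟨rfl⟩

end L1

/-! ### Rate distortion dimension -/

section RateDistortionDimension

variable (k : ℕ) {X : Type u} [MetricSpace X] [MeasurableSpace X] [AddAction (Fin k → ℝ) X]

variable {k} in
/-- `R(ε, A)`: the infimum of `I (Z; Y)` over all pairs of random variables `Z`, `Y` on a common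
probability space, where `Z` has law `μ`, `Y` takes values in `L¹(A, X)`, and the expected value of
`m(A)⁻¹ ∫_A d (T^v Z, Y_v) dv` is less than `ε`. -/
def rateOn (μ : Measure X) (ε : ℝ) (A : Set (Fin k → ℝ)) : ℝ≥0∞ :=
  sInf {r : ℝ≥0∞ | ∃ (Ω : Type u) (_ : MeasurableSpace Ω) (P : Measure Ω)
    (Z : Ω → X) (Y : Ω → L1Space A X),
    IsProbabilityMeasure P ∧ Measurable Z ∧ Measurable Y ∧ P.map Z = μ ∧
    ∫⁻ ω, (volume A)⁻¹ * (∫⁻ v in A, edist (v +ᵥ Z ω) ((Y ω).rep v)) ∂P < ENNReal.ofReal ε ∧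
    r = mutualInfo P Z Y}

/-- The rate distortion function `R(d, μ, ε) = lim_{L → ∞} R(ε, [0,L)^k) / L^k`. For invariant `μ`
the limit exists, so that it is given by the limit inferior. -/
def rateDistortion (μ : Measure X) (ε : ℝ) : ℝ≥0∞ :=
  liminf (fun L : ℝ => rateOn μ ε (halfOpenCube k L) / ENNReal.ofReal (L ^ k)) atTop

/-- The lower rate distortion dimension of `(X, T, d, μ)`. -/
def lowerRateDistortionDim (μ : Measure X) : ℝ≥0∞ :=
  liminf (fun ε : ℝ => rateDistortion k μ ε / ENNReal.ofReal (Real.logb 2 (1 / ε))) (𝓝[>] 0)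

end RateDistortionDimension

/-! ### Averaged measures -/

section Averages

variable (k : ℕ) {X : Type u} [MetricSpace X] [CompactSpace X] [MeasurableSpace X] [BorelSpace X]
  [AddAction (Fin k → ℝ) X] [ContinuousVAdd (Fin k → ℝ) X]

/-- `L^{-k} ∫_{[0,L]^k} T^v_* ν dv`. -/
def avgMeasure (L : ℝ) (ν : Measure X) : Measure X :=
  (ENNReal.ofReal (L ^ k))⁻¹ •
    (volume.restrict (cube k L)).bind fun v : Fin k → ℝ => ν.map fun x => v +ᵥ x

theorem aemeasurable_map_vadd (L : ℝ) (ν : Measure X) [SFinite ν] :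
    AEMeasurable (fun v : Fin k → ℝ => ν.map fun x => v +ᵥ x) (volume.restrict (cube k L)) := by
  apply Measurable.aemeasurable
  refine Measure.measurable_of_measurable_coe _ fun s hs => ?_
  have hc : Continuous fun p : (Fin k → ℝ) × X => p.1 +ᵥ p.2 := continuous_vadd
  have h := measurable_measure_prodMk_left (ν := ν) (hc.measurable hs)
  have heq : (fun v : Fin k → ℝ => (ν.map fun x => v +ᵥ x) s) = fun v : Fin k → ℝ =>
      ν (Prod.mk v ⁻¹' ((fun p : (Fin k → ℝ) × X => p.1 +ᵥ p.2) ⁻¹' s)) := by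
    funext v
    have hv : Continuous fun x : X => v +ᵥ x := continuous_const_vadd v
    rw [Measure.map_apply hv.measurable hs]
    rfl
  rw [heq]
  exact h

theorem isProbabilityMeasure_avgMeasure {L : ℝ} (hL : 0 < L) (ν : Measure X)
    [IsProbabilityMeasure ν] : IsProbabilityMeasure (avgMeasure k L ν) := by
  constructor
  have h1 : ∀ v : Fin k → ℝ, (ν.map fun x => v +ᵥ x) univ = 1 := fun v => by
    have hv : Continuous fun x : X => v +ᵥ x := continuous_const_vadd v
    rw [Measure.map_apply hv.measurable MeasurableSet.univ]
    simp
  have h2 : volume (cube k L) = ENNReal.ofReal (L ^ k) := by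
    rw [cube, volume_pi_pi]
    simp [ENNReal.ofReal_pow hL.le]
  rw [avgMeasure, Measure.smul_apply, Measure.bind_apply MeasurableSet.univ
    (aemeasurable_map_vadd k L ν)]
  simp only [h1, lintegral_const, Measure.restrict_apply_univ, one_mul, smul_eq_mul, h2]
  exact ENNReal.inv_mul_cancel (by simpa using pow_pos hL k) ENNReal.ofReal_ne_top

/-- `avgMeasure` as a Borel probability measure. -/
def avgProb {L : ℝ} (hL : 0 < L) (ν : ProbabilityMeasure X) : ProbabilityMeasure X :=
  ⟨avgMeasure k L (ν : Measure X), isProbabilityMeasure_avgMeasure k hL _⟩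

end Averages

end RateDistortion

end

/-! A code that reproduces blocks `[0, L)^k` with small average distortion can be used on every tile
of the large cube `[0, L_n]^k`. There it competes with hypothesis 1, by which sets of orbits that
stay close together have tiny `ν_n`-measure. So the code must carry much information per tile.

Take a coupling `(Z, Y)` on one block and quantize it to finitely many cells `c` and reproductions
`j`, with conditional law `W c` and marginal `q`. Then `log 2 * I` is the mean over `c` of the
relative entropy of `W c` with respect to `q`. Tile the large cube by blocks, shifted by `u ∈ [0,
L)^k`, and run `W` independently on the tiles. By convex duality (`sum_finKL_add_distortion_ge`),
any `b` is at most the total relative entropy, plus `b / t` times the expected distortion, plus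
`e^b` times the probability under the product of copies of `q` that the distortion is below `t`.
Integrating in `x` against `ν_n` and then in `u` turns the sum over tiles into an integral against
`μ_n`. The last term contributes at most a constant as soon as, for each fixed reproduction `y`, the
set of `x` with distortion below `t` has `ν_n`-measure at most `e^{-b}`
(`le_sum_finKL_add_distortion`). Since `y` is fixed before `x` is drawn, `ν_n` need not be
invariant.

Two points of such a set have orbits at integrated distance at most `2t`, so at scale `s` they are
`d̄_1`-close at all but few lattice times. A union bound over the exceptional times and over a cover
by `R = #(X, d̄_1, s)` sets splits the set into pieces of `d_{L_n}`-diameter at most `2Cs`, to which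
hypothesis 1 applies (`measureReal_le_of_pathDist_le`). With `s = ε^(1 - η)`, tame growth makes the
factor `R^(2t/s)` at most `e^{L_n^k / 2}`. Hence `b` can be about `M_n log (1/s)`. Letting `n → ∞`,
with cells of `μ`-null frontier, bounds the rate from below (`ofReal_le_rateOn`); then `ε → 0`,
while `η` is chosen according to the loss allowed. -/

namespace RateDistortion

/-! ### Relative entropy on finite sets and product channels. -/

section FiniteInformation

/-- Relative entropy (in nats) of `w` with respect to `q` on a finite set. -/
noncomputable def finKL {J : Type*} [Fintype J] (w q : J → ℝ) : ℝ :=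
  ∑ j, w j * Real.log (w j / q j)

/-- Fenchel–Young duality between relative entropy and the exponential: it is `log x ≥ 1 - 1/x` at
`x = w / (q e^F)`. The test value `F` is free, and different values are used on different events. -/
theorem mul_log_div_ge {w q : ℝ} (hw : 0 ≤ w) (hq : 0 ≤ q) (h : q = 0 → w = 0) (F : ℝ) :
    w * F + w - q * Real.exp F ≤ w * Real.log (w / q) := by
  rcases hw.eq_or_lt with rfl | hw
  · have := mul_nonneg hq (Real.exp_pos F).le
    simpa using this
  have hq : 0 < q := hq.lt_of_ne fun h0 => hw.ne' (h h0.symm)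
  have h1 := Real.one_sub_inv_le_log_of_pos (x := w / (q * Real.exp F)) (by positivity)
  rw [Real.log_div hw.ne' (by positivity), Real.log_mul hq.ne' (Real.exp_pos F).ne',
    Real.log_exp, inv_div] at h1
  rw [Real.log_div hw.ne' hq.ne']
  have h2 := mul_le_mul_of_nonneg_left h1 hw.le
  have h3 : w * (1 - q * Real.exp F / w) = w - q * Real.exp F := by field_simp
  rw [h3] at h2
  linarith

theorem finKL_nonneg {J : Type*} [Fintype J] {w q : J → ℝ} (hw : ∀ j, 0 ≤ w j)
    (hq : ∀ j, 0 ≤ q j) (h : ∀ j, q j = 0 → w j = 0) (hw1 : ∑ j, w j = 1) (hq1 : ∑ j, q j = 1) :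
    0 ≤ finKL w q := by
  have : ∑ j, (w j * 0 + w j - q j * Real.exp 0) ≤ finKL w q :=
    Finset.sum_le_sum fun j _ => mul_log_div_ge (hw j) (hq j) (h j) 0
  simpa [Finset.sum_sub_distrib, hw1, hq1] using this

variable {ι J : Type*} [Fintype ι] [DecidableEq ι] [Fintype J]

theorem sum_prod_eq_one {w : ι → J → ℝ} (hw : ∀ i, ∑ j, w i j = 1) :
    ∑ y : ι → J, ∏ i, w i (y i) = 1 := by
  classical
  have h := Finset.prod_univ_sum (fun _ : ι => (Finset.univ : Finset J)) w
  rw [Fintype.piFinset_univ] at h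
  rw [← h]
  simp [hw]

theorem sum_prod_mul_apply {w : ι → J → ℝ} (hw : ∀ i, ∑ j, w i j = 1) (i₀ : ι) (h : J → ℝ) :
    ∑ y : ι → J, (∏ i, w i (y i)) * h (y i₀) = ∑ j, w i₀ j * h j := by
  classical
  have h1 := Finset.prod_univ_sum (fun _ : ι => (Finset.univ : Finset J))
    (fun i j => w i j * if i = i₀ then h j else 1)
  rw [Fintype.piFinset_univ] at h1
  have h2 : ∏ i, ∑ j, (w i j * if i = i₀ then h j else 1) = ∑ j, w i₀ j * h j := by
    rw [Finset.prod_eq_single i₀]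
    · simp
    · intro i _ hi
      simp [hi, hw]
    · simp
  rw [← h2, h1]
  refine Finset.sum_congr rfl fun y _ => ?_
  rw [Finset.prod_mul_distrib]
  simp

theorem sum_prod_mul_sum {w : ι → J → ℝ} (hw : ∀ i, ∑ j, w i j = 1) (h : ι → J → ℝ) :
    ∑ y : ι → J, (∏ i, w i (y i)) * ∑ i, h i (y i) = ∑ i, ∑ j, w i j * h i j := by
  simp_rw [Finset.mul_sum]
  rw [Finset.sum_comm]
  exact Finset.sum_congr rfl fun i _ => sum_prod_mul_apply hw i (h i)

/-- Relative entropy of a product channel dominates the probability of a low distortion event. -/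
theorem sum_finKL_add_distortion_ge {w : ι → J → ℝ} {q : J → ℝ} (hw0 : ∀ i j, 0 ≤ w i j)
    (hw1 : ∀ i, ∑ j, w i j = 1) (hq0 : ∀ j, 0 ≤ q j) (hq1 : ∑ j, q j = 1)
    (hac : ∀ i j, q j = 0 → w i j = 0) {D : ι → J → ℝ} (hD : ∀ i j, 0 ≤ D i j)
    {b t : ℝ} (hb : 0 ≤ b) (ht : 0 < t) :
    b ≤ ∑ i, (finKL (w i) q + b / t * ∑ j, w i j * D i j) +
      Real.exp b * ∑ y : ι → J, (∏ i, q (y i)) *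
        (if ∑ i, D i (y i) < t then 1 else 0) := by
  -- Duality is applied to each `y` separately, with `F = b` when the distortion is below `t` and `F
  -- = 0` otherwise. In the second case the distortion term alone pays for `b`. After summation over
  -- `y`, the extra `A` and `B` both contribute 1 and cancel.
  have key : ∀ y : ι → J,
      (∏ i, w i (y i)) * (1 + b) - (∏ i, q (y i)) -
        Real.exp b * ((∏ i, q (y i)) * (if ∑ i, D i (y i) < t then 1 else 0)) ≤
      (∏ i, w i (y i)) * ∑ i, (Real.log (w i (y i) / q (y i)) + b / t * D i (y i)) := by
    intro y
    set A := ∏ i, w i (y i) with hA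
    set B := ∏ i, q (y i) with hB
    have hA0 : 0 ≤ A := Finset.prod_nonneg fun i _ => hw0 i _
    have hB0 : 0 ≤ B := Finset.prod_nonneg fun i _ => hq0 _
    have hBA : B = 0 → A = 0 := by
      intro h
      obtain ⟨i, -, hi⟩ := Finset.prod_eq_zero_iff.1 h
      exact Finset.prod_eq_zero (Finset.mem_univ i) (hac i _ hi)
    have hlog : A * ∑ i, Real.log (w i (y i) / q (y i)) = A * Real.log (A / B) := by
      by_cases h : A = 0
      · simp [h]
      have hw' : ∀ i, w i (y i) ≠ 0 := fun i hi => h (Finset.prod_eq_zero (Finset.mem_univ i) hi)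
      have hq' : ∀ i, q (y i) ≠ 0 := fun i hi => hw' i (hac i _ hi)
      rw [hA, hB, ← Finset.prod_div_distrib, Real.log_prod fun i _ => div_ne_zero (hw' i) (hq' i)]
    have hS0 : 0 ≤ ∑ i, D i (y i) := Finset.sum_nonneg fun i _ => hD i _
    rw [Finset.sum_add_distrib, ← Finset.mul_sum, mul_add _ (∑ i, Real.log _), hlog]
    split_ifs with h
    · have h1 := mul_log_div_ge hA0 hB0 hBA b
      have h2 : 0 ≤ A * (b / t * ∑ i, D i (y i)) := by positivity
      nlinarith
    · have h1 := mul_log_div_ge hA0 hB0 hBA 0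
      have h2 : b ≤ b / t * ∑ i, D i (y i) := by
        rw [div_mul_eq_mul_div, le_div_iff₀ ht]
        exact mul_le_mul_of_nonneg_left (not_lt.1 h) hb
      have h3 := mul_le_mul_of_nonneg_left h2 hA0
      simp only [Real.exp_zero] at h1
      nlinarith
  have hsum := Finset.sum_le_sum fun y (_ : y ∈ Finset.univ) => key y
  rw [sum_prod_mul_sum hw1 fun i j => Real.log (w i j / q j) + b / t * D i j,
    Finset.sum_sub_distrib, Finset.sum_sub_distrib, ← Finset.sum_mul, sum_prod_eq_one hw1,
    sum_prod_eq_one (w := fun _ => q) fun _ => hq1, ← Finset.mul_sum] at hsum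
  have heq : ∀ i, finKL (w i) q + b / t * ∑ j, w i j * D i j =
      ∑ j, w i j * (Real.log (w i j / q j) + b / t * D i j) := by
    intro i
    rw [finKL, Finset.mul_sum, ← Finset.sum_add_distrib]
    exact Finset.sum_congr rfl fun j _ => by ring
  simp_rw [heq]
  linarith

end FiniteInformation

/-! ### Conditional laws and mutual information in finite alphabets. -/

section Channel

variable {Ω : Type*} [MeasurableSpace Ω] {S S' : Type*}

/-- The conditional distribution of `V` given `U`. -/
noncomputable def condLaw (P : Measure Ω) (U : Ω → S) (V : Ω → S') (c : S) (j : S') : ℝ :=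
  open Classical in
  -- On null cells the marginal is the default value. This keeps every row a probability vector that
  -- is absolutely continuous with respect to the marginal.
  if P.real (U ⁻¹' {c}) = 0 then P.real (V ⁻¹' {j})
  else P.real (U ⁻¹' {c} ∩ V ⁻¹' {j}) / P.real (U ⁻¹' {c})

variable {P : Measure Ω} {U : Ω → S} {V : Ω → S'}

theorem condLaw_nonneg (c : S) (j : S') : 0 ≤ condLaw P U V c j := by
  unfold condLaw
  split_ifs <;> positivity

theorem condLaw_eq_zero [IsFiniteMeasure P] (c : S) (j : S') (hj : P.real (V ⁻¹' {j}) = 0) :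
    condLaw P U V c j = 0 := by
  have h : P.real (U ⁻¹' {c} ∩ V ⁻¹' {j}) = 0 :=
    measureReal_mono_null inter_subset_right hj
  unfold condLaw
  split_ifs <;> simp [hj, h]

theorem real_mul_condLaw [IsFiniteMeasure P] (c : S) (j : S') :
    P.real (U ⁻¹' {c}) * condLaw P U V c j = P.real (U ⁻¹' {c} ∩ V ⁻¹' {j}) := by
  unfold condLaw
  split_ifs with h
  · rw [h, measureReal_mono_null inter_subset_left h, zero_mul]
  · field_simp

variable [Fintype S'] [MeasurableSpace S] [MeasurableSingletonClass S]
  [MeasurableSpace S'] [MeasurableSingletonClass S']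

theorem sum_real_inter_preimage {T : Type*} [Fintype T] [MeasurableSpace T]
    [MeasurableSingletonClass T] (P : Measure Ω) [IsFiniteMeasure P] {V : Ω → T}
    (hV : Measurable V) {A : Set Ω} (hA : MeasurableSet A) : ∑ j, P.real (A ∩ V ⁻¹' {j}) = P.real A := by
  classical
  rw [← measureReal_biUnion_finset]
  · congr 1
    ext ω
    simp
  · intro i _ j _ hij
    refine Set.disjoint_left.2 fun ω h1 h2 => hij ?_
    have e1 : V ω = i := h1.2
    have e2 : V ω = j := h2.2
    exact e1.symm.trans e2
  · exact fun j _ => hA.inter (hV (measurableSet_singleton j))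

theorem sum_preimage_real [IsProbabilityMeasure P] (hV : Measurable V) : ∑ j, P.real (V ⁻¹' {j}) = 1 := by
  simpa using sum_real_inter_preimage P hV MeasurableSet.univ

theorem sum_condLaw [IsProbabilityMeasure P] (hU : Measurable U) (hV : Measurable V) (c : S) : ∑ j, condLaw P U V c j = 1 := by
  unfold condLaw
  split_ifs with h
  · exact sum_preimage_real hV
  · rw [← Finset.sum_div, sum_real_inter_preimage P hV (hU (measurableSet_singleton c)), div_self h]

/-- Write both marginal entropies as sums over the joint law and compare term by term; terms of
joint probability zero vanish. The factor `log 2` converts bits to nats. -/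
theorem log_two_mul_finiteMutualInfo [Fintype S] [IsProbabilityMeasure P] (hU : Measurable U) (hV : Measurable V) :
    Real.log 2 * finiteMutualInfo P U V =
      ∑ c, P.real (U ⁻¹' {c}) * finKL (condLaw P U V c) fun j => P.real (V ⁻¹' {j}) := by
  have h2 : Real.log 2 ≠ 0 := (Real.log_pos one_lt_two).ne'
  have hent : ∀ {p : ℝ}, Real.log 2 * (p * Real.logb 2 p) = p * Real.log p := by
    intro p
    rw [Real.logb]
    field_simp
  have hUV : ∀ c j, (fun ω => (U ω, V ω)) ⁻¹' {(c, j)} = U ⁻¹' {c} ∩ V ⁻¹' {j} := by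
    intro c j
    ext ω
    simp
  simp only [finiteMutualInfo, shannonEntropy, Fintype.sum_prod_type, hUV]
  simp only [mul_sub, mul_add, mul_neg, Finset.mul_sum, hent]
  have hp : ∑ c, P.real (U ⁻¹' {c}) * Real.log (P.real (U ⁻¹' {c})) =
      ∑ c, ∑ j, P.real (U ⁻¹' {c} ∩ V ⁻¹' {j}) * Real.log (P.real (U ⁻¹' {c})) := by
    refine Finset.sum_congr rfl fun c _ => ?_
    rw [← Finset.sum_mul, sum_real_inter_preimage P hV (hU (measurableSet_singleton c))]
  have hq : ∑ j, P.real (V ⁻¹' {j}) * Real.log (P.real (V ⁻¹' {j})) =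
      ∑ c, ∑ j, P.real (U ⁻¹' {c} ∩ V ⁻¹' {j}) * Real.log (P.real (V ⁻¹' {j})) := by
    rw [Finset.sum_comm]
    refine Finset.sum_congr rfl fun j _ => ?_
    rw [← Finset.sum_mul]
    congr 1
    rw [← sum_real_inter_preimage P hU (hV (measurableSet_singleton j))]
    exact Finset.sum_congr rfl fun c _ => by rw [inter_comm]
  rw [hp, hq, ← sub_eq_zero]
  simp only [finKL, Finset.mul_sum]
  simp only [← Finset.sum_neg_distrib, ← Finset.sum_add_distrib, ← Finset.sum_sub_distrib]
  refine Finset.sum_eq_zero fun c _ => Finset.sum_eq_zero fun j _ => ?_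
  rw [← mul_assoc, real_mul_condLaw]
  by_cases hr : P.real (U ⁻¹' {c} ∩ V ⁻¹' {j}) = 0
  · simp [hr]
  have hp0 : P.real (U ⁻¹' {c}) ≠ 0 := fun h => hr (measureReal_mono_null inter_subset_left h)
  have hq0 : P.real (V ⁻¹' {j}) ≠ 0 := fun h => hr (measureReal_mono_null inter_subset_right h)
  rw [condLaw, if_neg hp0, Real.log_div (div_ne_zero hr hp0) hq0, Real.log_div hr hp0]
  ring

end Channel

/-! ### Tilings of `ℝ^k` by half-open cubes. -/

section Tiling

variable {k : ℕ}

theorem measurableSet_halfOpenCube (k : ℕ) (L : ℝ) : MeasurableSet (halfOpenCube k L) :=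
  MeasurableSet.univ_pi fun _ => measurableSet_Ico

theorem volume_halfOpenCube (k : ℕ) {L : ℝ} (hL : 0 ≤ L) :
    volume (halfOpenCube k L) = ENNReal.ofReal (L ^ k) := by
  rw [halfOpenCube, volume_pi_pi]
  simp [ENNReal.ofReal_pow hL]

theorem halfOpenCube_subset_cube (k : ℕ) (L : ℝ) : halfOpenCube k L ⊆ cube k L :=
  Set.pi_mono fun _ _ => Ico_subset_Icc_self

theorem isCompact_cube (k : ℕ) (L : ℝ) : IsCompact (cube k L) :=
  isCompact_univ_pi fun _ => isCompact_Icc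

theorem halfOpenCube_ae_eq_cube (k : ℕ) (L : ℝ) :
    halfOpenCube k L =ᵐ[volume] cube k L := by
  rw [cube, pi_univ_Icc]
  exact Measure.univ_pi_Ico_ae_eq_Icc (f := fun _ => (0 : ℝ)) (g := fun _ => L)

/-- The cube of side `h` with lower corner `o + h z`. -/
def tile (h : ℝ) (o : Fin k → ℝ) (z : Fin k → ℕ) : Set (Fin k → ℝ) :=
  {w | (w - fun i => o i + h * z i) ∈ halfOpenCube k h}

theorem measurableSet_tile (h : ℝ) (o : Fin k → ℝ) (z : Fin k → ℕ) :
    MeasurableSet (tile h o z) :=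
  (measurable_id.sub_const _) (measurableSet_halfOpenCube k h)

theorem mem_tile {h : ℝ} {o : Fin k → ℝ} {z : Fin k → ℕ} {w : Fin k → ℝ} :
    w ∈ tile h o z ↔ ∀ i, o i + h * z i ≤ w i ∧ w i < o i + h * (z i + 1) := by
  simp only [tile, halfOpenCube, mem_ofPred_eq, mem_univ_pi, mem_Ico, Pi.sub_apply]
  refine forall_congr' fun i => and_congr ?_ ?_ <;> constructor <;> intro h <;> linarith

theorem setLIntegral_tile (h : ℝ) (o : Fin k → ℝ) (z : Fin k → ℕ) (g : (Fin k → ℝ) → ℝ≥0∞) :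
    ∫⁻ w in tile h o z, g w =
      ∫⁻ u in halfOpenCube k h, g (u + fun i => o i + h * z i) := by
  have hp := measurePreserving_add_right (volume : Measure (Fin k → ℝ)) fun i => o i + h * z i
  rw [← hp.setLIntegral_comp_preimage_emb (measurableEmbedding_addRight _) g (tile h o z)]
  congr 3
  ext u
  simp [tile]

theorem pairwise_disjoint_tile {h : ℝ} (hh : 0 < h) (o : Fin k → ℝ) :
    Pairwise fun z z' => Disjoint (tile h o z) (tile h o z') := by
  intro z z' hne
  refine Set.disjoint_left.2 fun w hw hw' => hne (funext fun i => ?_)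
  rw [mem_tile] at hw hw'
  have h1 : (z i : ℝ) < z' i + 1 := by
    have := (hw i).1.trans_lt (hw' i).2
    exact lt_of_mul_lt_mul_left (by linarith) hh.le
  have h2 : (z' i : ℝ) < z i + 1 := by
    have := (hw' i).1.trans_lt (hw i).2
    exact lt_of_mul_lt_mul_left (by linarith) hh.le
  norm_cast at h1 h2
  omega

theorem sum_setLIntegral_tile_le {h : ℝ} (hh : 0 < h) (o : Fin k → ℝ)
    (Z : Finset (Fin k → ℕ)) {E : Set (Fin k → ℝ)} (hE : ∀ z ∈ Z, tile h o z ⊆ E)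
    (g : (Fin k → ℝ) → ℝ≥0∞) :
    ∑ z ∈ Z, ∫⁻ u in halfOpenCube k h, g (u + fun i => o i + h * z i) ≤ ∫⁻ w in E, g w := by
  simp_rw [← setLIntegral_tile]
  rw [← lintegral_biUnion_finset (fun z _ z' _ hne => pairwise_disjoint_tile hh o hne)
    fun z _ => measurableSet_tile h o z]
  exact lintegral_mono_set (iUnion₂_subset hE)

theorem setLIntegral_le_sum_tile {h : ℝ} (o : Fin k → ℝ)
    (Z : Finset (Fin k → ℕ)) {E : Set (Fin k → ℝ)} (hE : E ⊆ ⋃ z ∈ Z, tile h o z)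
    (g : (Fin k → ℝ) → ℝ≥0∞) :
    ∫⁻ w in E, g w ≤ ∑ z ∈ Z, ∫⁻ u in halfOpenCube k h, g (u + fun i => o i + h * z i) := by
  simp_rw [← setLIntegral_tile]
  refine (lintegral_mono_set hE).trans ?_
  have h1 : (⋃ z ∈ Z, tile h o z) = ⋃ z : Z, tile h o z := by
    ext w
    simp
  rw [h1, ← Finset.sum_coe_sort, ← tsum_fintype (L := SummationFilter.unconditional _)]
  exact lintegral_iUnion_le _ _

end Tiling

/-! ### Union bounds and lattice counts. -/

section Counting

/-- A union bound: points of `S` are sorted according to the set of indices `v` at which they are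
`Bad`, and according to which element of the cover contains `τ v x` for these `v`. -/
theorem measureReal_le_of_cover {X Λ : Type*} [MeasurableSpace X] [Fintype Λ]
    (ν : Measure X) [IsFiniteMeasure ν] {R : ℕ} (hR : 1 ≤ R) {U : Fin R → Set X}
    (hU : ∀ i, MeasurableSet (U i)) (hcov : (⋃ i, U i) = univ) {τ : Λ → X → X}
    (hτ : ∀ v, Measurable (τ v)) {Bad : Λ → Set X} (hBad : ∀ v, MeasurableSet (Bad v))
    {S : Set X} (hS : MeasurableSet S) {p κ : ℝ} (hκ : 0 ≤ κ)
    (hp : ∀ x ∈ S, ({v | x ∈ Bad v}.ncard : ℝ) ≤ p)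
    (hA : ∀ A ⊆ S, MeasurableSet A → (∀ v, Disjoint A (Bad v) ∨ ∃ i, A ⊆ τ v ⁻¹' U i) →
      ν.real A ≤ κ) :
    ν.real S ≤ 2 ^ Fintype.card Λ * (R : ℝ) ^ p * κ := by
  classical
  -- Here `B` contains the bad indices and `h` names a cover element for each of them. There are at
  -- most `2 ^ card Λ` choices of `B`, and at most `R ^ p` of `h`, because only sets with at most
  -- `p` elements occur.
  let A : (B : Finset Λ) → (B → Fin R) → Set X := fun B h =>
    S ∩ ((⋂ v ∈ Bᶜ, (Bad v)ᶜ) ∩ ⋂ v : B, τ v ⁻¹' U (h v))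
  have hAm : ∀ B h, MeasurableSet (A B h) := fun B h =>
    hS.inter ((Finset.measurableSet_biInter _ fun v _ => (hBad v).compl).inter
      (MeasurableSet.iInter fun v => hτ v (hU _)))
  have hAκ : ∀ B h, ν.real (A B h) ≤ κ := fun B h => by
    refine hA _ inter_subset_left (hAm B h) fun v => ?_
    by_cases hv : v ∈ B
    · exact Or.inr ⟨h ⟨v, hv⟩, fun x hx => mem_iInter.1 hx.2.2 ⟨v, hv⟩⟩
    · refine Or.inl (Set.disjoint_left.2 fun x hx => ?_)
      exact mem_iInter₂.1 hx.2.1 v (Finset.mem_compl.2 hv)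
  let 𝓑 : Finset (Finset Λ) := Finset.univ.filter fun B => (B.card : ℝ) ≤ p
  have hsub : S ⊆ ⋃ B ∈ 𝓑, ⋃ h ∈ (Finset.univ : Finset (B → Fin R)), A B h := by
    intro x hx
    have hc : ∀ v, ∃ i, τ v x ∈ U i := fun v => mem_iUnion.1 (hcov ▸ mem_univ (τ v x))
    choose h hh using hc
    let B : Finset Λ := Finset.univ.filter fun v => x ∈ Bad v
    have hB : B ∈ 𝓑 := by
      have := hp x hx
      rw [Set.ncard_eq_toFinset_card', Set.toFinset_ofPred] at this
      simpa [𝓑] using this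
    refine mem_iUnion₂.2 ⟨B, hB, mem_iUnion₂.2 ⟨fun v => h v, Finset.mem_univ _, hx, ?_, ?_⟩⟩
    · exact mem_iInter₂.2 fun v hv => by simpa [B] using hv
    · exact mem_iInter.2 fun v => hh v
  have hR' : (1 : ℝ) ≤ R := by exact_mod_cast hR
  calc ν.real S ≤ ν.real (⋃ B ∈ 𝓑, ⋃ h ∈ (Finset.univ : Finset (B → Fin R)), A B h) :=
        measureReal_mono hsub (measure_ne_top _ _)
    _ ≤ ∑ B ∈ 𝓑, ∑ h : B → Fin R, ν.real (A B h) :=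
        (measureReal_biUnion_finset_le _ _).trans
          (Finset.sum_le_sum fun B _ => measureReal_biUnion_finset_le _ _)
    _ ≤ ∑ B ∈ 𝓑, (R : ℝ) ^ p * κ := by
        refine Finset.sum_le_sum fun B hB => ?_
        refine (Finset.sum_le_sum fun h _ => hAκ B h).trans ?_
        rw [Finset.sum_const, Finset.card_univ, nsmul_eq_mul, Fintype.card_fun, Fintype.card_fin,
          Fintype.card_coe, Nat.cast_pow, ← Real.rpow_natCast]
        refine mul_le_mul_of_nonneg_right (Real.rpow_le_rpow_of_exponent_le hR' ?_) hκ
        simpa [𝓑] using hB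
    _ ≤ 2 ^ Fintype.card Λ * (R : ℝ) ^ p * κ := by
        rw [Finset.sum_const, nsmul_eq_mul, ← mul_assoc]
        refine mul_le_mul_of_nonneg_right (mul_le_mul_of_nonneg_right ?_ (by positivity)) hκ
        have : 𝓑.card ≤ 2 ^ Fintype.card Λ := by
          simpa using Finset.card_le_univ 𝓑
        exact_mod_cast this

theorem card_interior_lattice (k N K : ℕ) :
    (N - 2 * K) ^ k ≤ (Finset.univ.filter
      fun v : Fin k → Fin N => ∀ i, K ≤ (v i : ℕ) ∧ (v i : ℕ) + K < N).card := by
  have h : Function.Injective fun (v : Fin k → Fin (N - 2 * K)) (i : Fin k) =>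
      (⟨v i + K, by omega⟩ : Fin N) := by
    intro v v' hv
    funext i
    have := congrFun hv i
    simp only [Fin.mk.injEq] at this
    exact Fin.ext (by omega)
  calc (N - 2 * K) ^ k = (Finset.univ.map ⟨_, h⟩).card := by simp
    _ ≤ _ := Finset.card_le_card fun w hw => by
        obtain ⟨v, -, rfl⟩ := Finset.mem_map.1 hw
        simp only [Finset.mem_filter, Finset.mem_univ, true_and, Function.Embedding.coeFn_mk]
        intro i
        have := (v i).2
        omega

end Counting

/-! ### The averaged metric `d̄_1`, integrated orbit distance, and covers. -/

section PathDistance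

variable {k : ℕ} {X : Type u} [MetricSpace X] [AddAction (Fin k → ℝ) X]

/-- The integral over `A` of the distance between the orbits of `x` and `y`. -/
noncomputable def pathDist (A : Set (Fin k → ℝ)) (x y : X) : ℝ≥0∞ :=
  ∫⁻ v in A, edist (v +ᵥ x) (v +ᵥ y)

theorem pathDist_comm (A : Set (Fin k → ℝ)) (x y : X) : pathDist A x y = pathDist A y x := by
  simp only [pathDist, edist_comm]

theorem avgDist_nonneg (x y : X) : 0 ≤ avgDist k 1 x y :=
  mul_nonneg (by simp) (integral_nonneg fun _ => dist_nonneg)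

theorem avgDist_self (x : X) : avgDist k 1 x x = 0 := by
  simp [avgDist]

theorem avgDist_comm (x y : X) : avgDist k 1 x y = avgDist k 1 y x := by
  simp only [avgDist, dist_comm]

variable [ContinuousVAdd (Fin k → ℝ) X]

theorem continuous_edist_vadd (x y : X) :
    Continuous fun v : Fin k → ℝ => edist (v +ᵥ x) (v +ᵥ y) :=
  (continuous_id.vadd continuous_const).edist (continuous_id.vadd continuous_const)

theorem pathDist_triangle (A : Set (Fin k → ℝ)) (x y z : X) :
    pathDist A x z ≤ pathDist A x y + pathDist A y z := by
  rw [pathDist, pathDist, pathDist, ← lintegral_add_left (continuous_edist_vadd x y).measurable]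
  exact lintegral_mono fun v => edist_triangle _ _ _

/-- Closed and half-open cubes differ by a null set. The half-open one is used because its
translates tile disjointly. -/
theorem ofReal_avgDist (x y : X) :
    ENNReal.ofReal (avgDist k 1 x y) = pathDist (halfOpenCube k 1) x y := by
  have hc : Continuous fun v : Fin k → ℝ => dist (v +ᵥ x) (v +ᵥ y) :=
    (continuous_id.vadd continuous_const).dist (continuous_id.vadd continuous_const)
  rw [avgDist, one_pow, inv_one, one_mul, ofReal_integral_eq_lintegral_ofReal
    (hc.continuousOn.integrableOn_compact (isCompact_cube k 1))
    (Eventually.of_forall fun _ => dist_nonneg), pathDist,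
    Measure.restrict_congr_set (halfOpenCube_ae_eq_cube k 1)]
  simp only [edist_dist]

theorem avgDist_triangle (x y z : X) :
    avgDist k 1 x z ≤ avgDist k 1 x y + avgDist k 1 y z := by
  rw [← ENNReal.ofReal_le_ofReal_iff (add_nonneg (avgDist_nonneg x y) (avgDist_nonneg y z)),
    ENNReal.ofReal_add (avgDist_nonneg x y) (avgDist_nonneg y z), ofReal_avgDist, ofReal_avgDist,
    ofReal_avgDist]
  exact pathDist_triangle _ x y z

variable [CompactSpace X]

theorem exists_dist_vadd_lt (L : ℝ) {γ : ℝ} (hγ : 0 < γ) :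
    ∃ r > 0, ∀ x y : X, dist x y < r → ∀ v ∈ cube k L, dist (v +ᵥ x) (v +ᵥ y) < γ := by
  have hK : IsCompact (cube k L ×ˢ (univ : Set X)) := (isCompact_cube k L).prod isCompact_univ
  have hc : UniformContinuousOn (fun p : (Fin k → ℝ) × X => p.1 +ᵥ p.2) (cube k L ×ˢ univ) :=
    hK.uniformContinuousOn_of_continuous continuous_vadd.continuousOn
  obtain ⟨r, hr, h⟩ := Metric.uniformContinuousOn_iff.1 hc γ hγ
  refine ⟨r, hr, fun x y hxy v hv => h (v, x) ⟨hv, mem_univ _⟩ (v, y) ⟨hv, mem_univ _⟩ ?_⟩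
  simpa [Prod.dist_eq, hr] using hxy

theorem exists_pathDist_le {L : ℝ} (hL : 0 < L) {γ : ℝ} (hγ : 0 < γ) :
    ∃ r > 0, ∀ x y : X, dist x y < r → pathDist (halfOpenCube k L) x y ≤ ENNReal.ofReal γ := by
  have hLk : 0 < L ^ k := pow_pos hL k
  obtain ⟨r, hr, h⟩ := exists_dist_vadd_lt (X := X) (k := k) L (div_pos hγ hLk)
  refine ⟨r, hr, fun x y hxy => ?_⟩
  calc pathDist (halfOpenCube k L) x y
      ≤ ∫⁻ _ in halfOpenCube k L, ENNReal.ofReal (γ / L ^ k) := by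
        refine setLIntegral_mono' (measurableSet_halfOpenCube k L) fun v hv => ?_
        rw [edist_dist]
        exact ENNReal.ofReal_le_ofReal (h x y hxy v (halfOpenCube_subset_cube k L hv)).le
    _ = ENNReal.ofReal γ := by
        rw [setLIntegral_const, volume_halfOpenCube k hL.le, ← ENNReal.ofReal_mul (by positivity),
          div_mul_cancel₀ _ hLk.ne']

theorem continuous_avgDist : Continuous fun p : X × X => avgDist k 1 p.1 p.2 := by
  refine continuous_const.mul ?_
  refine continuous_parametric_integral_of_continuous (μ := volume)
    (f := fun (p : X × X) (v : Fin k → ℝ) => dist (v +ᵥ p.1) (v +ᵥ p.2)) ?_ (isCompact_cube k 1)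
  exact (continuous_snd.vadd (continuous_fst.comp continuous_fst)).dist
    (continuous_snd.vadd (continuous_snd.comp continuous_fst))

theorem bddAbove_avgDist : ∃ B, ∀ x y : X, avgDist k 1 x y ≤ B := by
  obtain ⟨B, hB⟩ := (isCompact_range (continuous_avgDist (X := X) (k := k))).bddAbove
  exact ⟨B, fun x y => hB ⟨(x, y), rfl⟩⟩

theorem diamWrt_nonneg {Y : Type*} {ρ : Y → Y → ℝ} (hρ : ∀ x y, 0 ≤ ρ x y) (A : Set Y) :
    0 ≤ diamWrt ρ A :=
  Real.sSup_nonneg fun _ ⟨x, _, y, _, h⟩ => h ▸ hρ x y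

theorem diamWrt_le {Y : Type*} {ρ : Y → Y → ℝ} {A : Set Y} {r : ℝ} (hr : 0 ≤ r)
    (h : ∀ x ∈ A, ∀ y ∈ A, ρ x y ≤ r) : diamWrt ρ A ≤ r :=
  Real.sSup_le (fun _ ⟨x, hx, y, hy, e⟩ => e ▸ h x hx y hy) hr

theorem isOpen_of_isOpenWrt {U : Set X} (hU : IsOpenWrt (avgDist k 1) U) : IsOpen U := by
  rw [isOpen_iff_mem_nhds]
  intro x hx
  obtain ⟨r, hr, h⟩ := hU x hx
  have hc : Continuous fun y => avgDist k 1 x y :=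
    continuous_avgDist.comp (continuous_const.prodMk continuous_id)
  refine mem_of_superset ((isOpen_Iio.preimage hc).mem_nhds ?_) h
  simpa [avgDist_self] using hr

/-- Covers by `coveringNumber` many small open sets exist. -/
theorem exists_cover {s : ℝ} (hs : 0 < s) :
    ∃ U : Fin (coveringNumber (avgDist k 1 : X → X → ℝ) s) → Set X,
      (∀ i, IsOpen (U i)) ∧ (∀ i, ∀ x ∈ U i, ∀ y ∈ U i, avgDist k 1 x y < s) ∧
      (⋃ i, U i) = univ := by
  obtain ⟨U, h1, h2, h3⟩ : coveringNumber (avgDist k 1 : X → X → ℝ) s ∈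
      {n : ℕ | ∃ U : Fin n → Set X, (∀ i, IsOpenWrt (avgDist k 1) (U i)) ∧
        (∀ i, diamWrt (avgDist k 1) (U i) < s) ∧ (⋃ i, U i) = univ} := by
    refine Nat.sInf_mem ?_
    have hopen : ∀ x : X, IsOpenWrt (avgDist k 1) {y | avgDist k 1 x y < s / 3} := by
      intro x y hy
      refine ⟨s / 3 - avgDist k 1 x y, sub_pos.2 hy, fun z hz => ?_⟩
      have := avgDist_triangle (k := k) x y z
      have hz' : avgDist k 1 y z < s / 3 - avgDist k 1 x y := hz
      show avgDist k 1 x z < s / 3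
      linarith
    obtain ⟨t, ht⟩ := isCompact_univ.elim_finite_subcover
      (fun x : X => {y | avgDist k 1 x y < s / 3}) (fun x => isOpen_of_isOpenWrt (hopen x))
      fun x _ => mem_iUnion.2 ⟨x, by simpa [avgDist_self] using hs⟩
    refine ⟨t.card, fun i => {y | avgDist k 1 (t.equivFin.symm i : X) y < s / 3},
      fun i => hopen _, fun i => ?_, ?_⟩
    · refine (diamWrt_le (r := 2 * (s / 3)) (by positivity) fun x hx y hy => ?_).trans_lt
        (by linarith)
      have h1 : avgDist k 1 (t.equivFin.symm i : X) x < s / 3 := hx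
      have h2 : avgDist k 1 (t.equivFin.symm i : X) y < s / 3 := hy
      have h3 := avgDist_triangle (k := k) x (t.equivFin.symm i : X) y
      rw [avgDist_comm] at h1
      linarith
    · refine eq_univ_of_forall fun y => ?_
      obtain ⟨x, hx, hxy⟩ := mem_iUnion₂.1 (ht (mem_univ y))
      exact mem_iUnion.2 ⟨t.equivFin ⟨x, hx⟩, by simpa using hxy⟩
  -- Boundedness makes the `sSup` in `diamWrt` a genuine supremum, so a small diameter does bound
  -- all pairwise distances.
  obtain ⟨B, hB⟩ := bddAbove_avgDist (X := X) (k := k)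
  refine ⟨U, fun i => isOpen_of_isOpenWrt (h1 i), fun i x hx y hy => ?_, h3⟩
  have hb : BddAbove {r : ℝ | ∃ x ∈ U i, ∃ y ∈ U i, r = avgDist k 1 x y} := by
    refine ⟨B, ?_⟩
    rintro _ ⟨x, _, y, _, rfl⟩
    exact hB x y
  exact (le_csSup hb ⟨x, hx, y, hy, rfl⟩).trans_lt (h2 i)

theorem one_le_coveringNumber [Nonempty X] {s : ℝ} (hs : 0 < s) :
    1 ≤ coveringNumber (avgDist k 1 : X → X → ℝ) s := by
  obtain ⟨U, -, -, h⟩ := exists_cover (X := X) (k := k) hs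
  obtain ⟨i, -⟩ := mem_iUnion.1 (h ▸ mem_univ (Classical.arbitrary X))
  exact Nat.one_le_iff_ne_zero.2 fun h0 => (Fin.cast h0 i).elim0

end PathDistance

/-! ### Measure of sets of points with nearby orbits. -/

section SmallSets

variable {k : ℕ} {X : Type u} [MetricSpace X] [AddAction (Fin k → ℝ) X]

theorem supDist_nonneg (A : Set (Fin k → ℝ)) (x y : X) : 0 ≤ supDist A x y :=
  Real.iSup_nonneg fun _ => dist_nonneg

variable [CompactSpace X]

theorem dist_le_supDist {A : Set (Fin k → ℝ)} {v : Fin k → ℝ} (hv : v ∈ A) (x y : X) :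
    dist (v +ᵥ x) (v +ᵥ y) ≤ supDist A x y := by
  refine le_ciSup (f := fun v : A => dist ((v : Fin k → ℝ) +ᵥ x) ((v : Fin k → ℝ) +ᵥ y))
    ⟨Metric.diam (univ : Set X), ?_⟩ ⟨v, hv⟩
  rintro _ ⟨v, rfl⟩
  exact Metric.dist_le_diam_of_mem isCompact_univ.isBounded (mem_univ _) (mem_univ _)

/-- The comparison hypothesis is applied to `-a +ᵥ x` and `-a +ᵥ y`, which moves the window `a + [0,
L]^k` back to `[0, L]^k`. It concerns integer sides only, hence the ceiling. -/
theorem supDist_cube_le {a : Fin k → ℝ} {C : ℝ} {l : ℕ} (hC : 0 < C)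
    (hcomp : ∀ L : ℕ, 0 < L → ∀ x y : X, supDist ((fun v => a + v) '' cube k (L : ℝ)) x y ≤
      C * latticeSupDist k (avgDist k 1) (L + l) x y)
    {L : ℝ} (hL : 0 < L) {r : ℝ} (hr : 0 ≤ r) {x y : X}
    (h : ∀ v : Fin k → Fin (⌈L⌉₊ + l),
      avgDist k 1 ((fun i => ((v i : ℕ) : ℝ)) +ᵥ (-a +ᵥ x)) ((fun i => ((v i : ℕ) : ℝ)) +ᵥ (-a +ᵥ y))
        ≤ r) :
    supDist (cube k L) x y ≤ C * r := by
  have h1 := hcomp ⌈L⌉₊ (Nat.ceil_pos.2 hL) (-a +ᵥ x) (-a +ᵥ y)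
  have h2 : latticeSupDist k (avgDist k 1) (⌈L⌉₊ + l) (-a +ᵥ x) (-a +ᵥ y) ≤ r :=
    Real.iSup_le h hr
  refine Real.iSup_le (fun v => ?_) (mul_nonneg hC.le hr)
  refine le_trans ?_ (h1.trans (mul_le_mul_of_nonneg_left h2 hC.le))
  have hv : a + (v : Fin k → ℝ) ∈ (fun v => a + v) '' cube k (⌈L⌉₊ : ℝ) := by
    refine ⟨v, fun i hi => ?_, rfl⟩
    have := v.2 i hi
    exact ⟨this.1, this.2.trans (Nat.le_ceil L)⟩
  have h3 := dist_le_supDist hv (-a +ᵥ x) (-a +ᵥ y)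
  simpa [vadd_vadd, add_comm, add_assoc] using h3

variable [ContinuousVAdd (Fin k → ℝ) X] [MeasurableSpace X] [BorelSpace X]

/-- A set of points whose orbits stay close on average has small measure. -/
theorem measureReal_le_of_pathDist_le {a : Fin k → ℝ} {C : ℝ} {l : ℕ} (hC : 0 < C)
    (hcomp : ∀ L : ℕ, 0 < L → ∀ x y : X, supDist ((fun v => a + v) '' cube k (L : ℝ)) x y ≤
      C * latticeSupDist k (avgDist k 1) (L + l) x y)
    {L M : ℝ} (hL : 0 < L) (hM : 0 < M) (ν : Measure X) [IsFiniteMeasure ν] {δ C' : ℝ}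
    (hC' : 0 < C')
    (hν : ∀ A : Set X, MeasurableSet A → diamWrt (supDist (cube k L)) A < δ →
      ν.real A ≤ (C' * diamWrt (supDist (cube k L)) A) ^ M)
    {s : ℝ} (hs : 0 < s) (hsδ : C * (2 * s) < δ) {N K : ℕ} (hN : N = ⌈L⌉₊ + l)
    {E : Set (Fin k → ℝ)}
    (hE : ∀ z : Fin k → ℕ, (∀ i, K ≤ z i ∧ z i + K < N) → tile 1 (-a) z ⊆ E)
    {S : Set X} (hS : MeasurableSet S) {τ : ℝ} (hτ : 0 ≤ τ)
    (hSE : ∀ x ∈ S, ∀ y ∈ S, pathDist E x y ≤ ENNReal.ofReal τ) :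
    ν.real S ≤ 2 ^ N ^ k * (coveringNumber (avgDist k 1 : X → X → ℝ) s : ℝ) ^
      (τ / s + ((N : ℝ) ^ k - ((N - 2 * K : ℕ) : ℝ) ^ k)) * (C' * (C * (2 * s))) ^ M := by
  rcases S.eq_empty_or_nonempty with rfl | ⟨x₀, hx₀⟩
  · rw [measureReal_empty]
    positivity
  have : Nonempty X := ⟨x₀⟩
  obtain ⟨U, hU1, hU2, hU3⟩ := exists_cover (X := X) (k := k) hs
  let T : (Fin k → Fin N) → X → X := fun v x => (fun i => ((v i : ℕ) : ℝ)) +ᵥ (-a +ᵥ x)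
  have hT : ∀ v, Continuous (T v) := fun v =>
    (continuous_const_vadd _).comp (continuous_const_vadd _)
  -- A time `v` is bad for `x` if the orbits of `x` and of the reference point `x₀` are at least `s`
  -- apart there.
  have hclosed : ∀ v, IsClosed {x | s ≤ avgDist k 1 (T v x) (T v x₀)} := fun v =>
    isClosed_le continuous_const
      (continuous_avgDist.comp ((hT v).prodMk continuous_const))
  have hcount := measureReal_le_of_cover ν (one_le_coveringNumber hs)
    (fun i => (hU1 i).measurableSet) hU3 (fun v => (hT v).measurable)
    (fun v => (hclosed v).measurableSet) hS
    (p := τ / s + ((N : ℝ) ^ k - ((N - 2 * K : ℕ) : ℝ) ^ k)) (κ := (C' * (C * (2 * s))) ^ M)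
    (by positivity) ?_ ?_
  · simpa using hcount
  · intro x hx
    classical
    let I : Finset (Fin k → Fin N) := Finset.univ.filter
      fun v => ∀ i, K ≤ (v i : ℕ) ∧ (v i : ℕ) + K < N
    let B : Finset (Fin k → Fin N) := Finset.univ.filter
      fun v => s ≤ avgDist k 1 (T v x) (T v x₀)
    have hBcard : {v | x ∈ {x | s ≤ avgDist k 1 (T v x) (T v x₀)}}.ncard = B.card := by
      rw [← Set.ncard_coe_finset]
      congr 1
      ext v
      simp [B]
    have hinj : Function.Injective fun (v : Fin k → Fin N) (i : Fin k) => (v i : ℕ) := by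
      intro v v' h
      exact funext fun i => Fin.ext (congrFun h i)
    -- For interior `v` the summands are integrals over disjoint unit cubes contained in `E`. By
    -- Markov's inequality at most `τ / s` interior times are bad; all the other times are simply
    -- counted as possibly bad.
    have hsum : ∑ v ∈ I, avgDist k 1 (T v x) (T v x₀) ≤ τ := by
      rw [← ENNReal.ofReal_le_ofReal_iff hτ, ENNReal.ofReal_sum_of_nonneg
        fun v _ => avgDist_nonneg _ _]
      refine le_trans ?_ (hSE x hx x₀ hx₀)
      have h1 := sum_setLIntegral_tile_le one_pos (-a) (I.map ⟨_, hinj⟩) (E := E)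
        (fun z hz => by
          obtain ⟨v, hv, rfl⟩ := Finset.mem_map.1 hz
          exact hE _ (Finset.mem_filter.1 hv).2)
        fun v => edist (v +ᵥ x) (v +ᵥ x₀)
      rw [Finset.sum_map] at h1
      refine le_trans (le_of_eq (Finset.sum_congr rfl fun v _ => ?_)) h1
      rw [ofReal_avgDist, pathDist]
      refine lintegral_congr fun u => ?_
      have : (u + fun i => (-a) i + 1 * (((⟨_, hinj⟩ : (Fin k → Fin N) ↪ (Fin k → ℕ)) v i : ℕ) : ℝ)) =
          u + ((fun i => ((v i : ℕ) : ℝ)) + -a) := by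
        funext i
        simp [add_comm]
      simp only [T]
      rw [this, ← vadd_vadd, ← vadd_vadd, ← vadd_vadd, ← vadd_vadd]
    have h1 : ((B ∩ I).card : ℝ) ≤ τ / s := by
      rw [le_div_iff₀ hs]
      refine le_trans ?_ hsum
      rw [← nsmul_eq_mul, ← Finset.sum_const]
      refine (Finset.sum_le_sum fun v hv => ?_).trans
        (Finset.sum_le_sum_of_subset_of_nonneg Finset.inter_subset_right
          fun v _ _ => avgDist_nonneg _ _)
      exact (Finset.mem_filter.1 (Finset.mem_inter.1 hv).1).2
    have h2 : ((B \ I).card : ℝ) ≤ (N : ℝ) ^ k - ((N - 2 * K : ℕ) : ℝ) ^ k := by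
      have h3 := Finset.card_le_card (Finset.sdiff_subset_sdiff (Finset.subset_univ B) le_rfl :
        B \ I ⊆ Finset.univ \ I)
      have h4 := Finset.card_sdiff_add_card_eq_card (Finset.subset_univ I)
      have h5 := card_interior_lattice k N K
      have h6 : (Finset.univ : Finset (Fin k → Fin N)).card = N ^ k := by simp
      have h7 : (B \ I).card + (N - 2 * K) ^ k ≤ N ^ k := by
        have : (N - 2 * K) ^ k ≤ I.card := h5
        omega
      rw [le_sub_iff_add_le]
      exact_mod_cast h7
    rw [hBcard, ← Finset.card_inter_add_card_sdiff B I, Nat.cast_add]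
    exact add_le_add h1 h2
  · intro A _ hAm hA
    have hdiam : diamWrt (supDist (cube k L)) A ≤ C * (2 * s) := by
      refine diamWrt_le (by positivity) fun x hx y hy => ?_
      subst hN
      refine supDist_cube_le hC hcomp hL (by positivity) fun v => ?_
      -- At a time good for all of `A`, two points are within `2s` via `x₀`. At any other time they
      -- lie in one cover element, of diameter below `s`.
      rcases hA v with h | ⟨i, h⟩
      · have hx' := Set.disjoint_left.1 h hx
        have hy' := Set.disjoint_left.1 h hy
        simp only [mem_ofPred_eq, not_le] at hx' hy'
        have := avgDist_triangle (k := k) (T v x) (T v x₀) (T v y)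
        rw [avgDist_comm (T v x₀)] at this
        linarith
      · have := hU2 i _ (h hx) _ (h hy)
        simp only [T] at this
        linarith
    refine (hν A hAm (hdiam.trans_lt hsδ)).trans ?_
    have h0 : 0 ≤ diamWrt (supDist (cube k L)) A := diamWrt_nonneg (supDist_nonneg _) A
    exact Real.rpow_le_rpow (by positivity) (mul_le_mul_of_nonneg_left hdiam hC'.le) hM.le

end SmallSets

/-! ### Quantization of the source and of the reproduction. -/

section Discretization

theorem null_frontier_biInter {X ι : Type*} [TopologicalSpace X] [MeasurableSpace X]
    {μ : Measure X} {A : ι → Set X} (hA : ∀ i, μ (frontier (A i)) = 0) (s : Finset ι) :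
    μ (frontier (⋂ i ∈ s, A i)) = 0 := by
  classical
  induction s using Finset.induction_on with
  | empty => simp
  | insert i s _ ih =>
    rw [Finset.set_biInter_insert]
    exact null_frontier_inter (hA i) ih

/-- A compact metric space has finite partitions into small sets with null frontiers. -/
theorem exists_partition_null_frontier {X : Type*} [MetricSpace X] [CompactSpace X]
    [MeasurableSpace X] [BorelSpace X] (μ : Measure X) [IsFiniteMeasure μ] {r : ℝ} (hr : 0 < r) :
    ∃ (m : ℕ) (f : X → Fin m) (p : Fin m → X), Measurable f ∧
      (∀ c, μ (frontier (f ⁻¹' {c})) = 0) ∧ ∀ x, dist x (p (f x)) < r := by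
  have hρ : ∀ x : X, ∃ ρ, ρ ∈ Ioo 0 r ∧ μ (frontier (Metric.ball x ρ)) = 0 := by
    intro x
    obtain ⟨ρ, h1, h2⟩ := exists_null_frontier_thickening μ {x} hr
    exact ⟨ρ, h1, by rwa [Metric.thickening_singleton] at h2⟩
  choose ρ hρ1 hρ2 using hρ
  obtain ⟨t, ht⟩ := isCompact_univ.elim_finite_subcover (fun x : X => Metric.ball x (ρ x))
    (fun x => Metric.isOpen_ball) fun x _ => mem_iUnion.2 ⟨x, Metric.mem_ball_self (hρ1 x).1⟩
  let p : Fin t.card → X := fun i => t.equivFin.symm i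
  let A : Fin t.card → Set X := fun i => Metric.ball (p i) (ρ (p i))
  have hcov : ∀ x, ∃ i, x ∈ A i := by
    intro x
    obtain ⟨y, hy, hxy⟩ := mem_iUnion₂.1 (ht (mem_univ x))
    exact ⟨t.equivFin ⟨y, hy⟩, by simpa [A, p] using hxy⟩
  classical
  have hne : ∀ x, (Finset.univ.filter fun i => x ∈ A i).Nonempty := fun x =>
    (hcov x).imp fun i hi => by simpa using hi
  let f : X → Fin t.card := fun x => (Finset.univ.filter fun i => x ∈ A i).min' (hne x)
  have hmem : ∀ x, x ∈ A (f x) := fun x =>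
    (Finset.mem_filter.1 (Finset.min'_mem _ (hne x))).2
  -- Each point is assigned to the first ball containing it. The cells are then finite Boolean
  -- combinations of balls with null frontier.
  have hpre : ∀ c, f ⁻¹' {c} = A c ∩ ⋂ i ∈ Finset.univ.filter (· < c), (A i)ᶜ := by
    intro c
    ext x
    simp only [mem_preimage, mem_singleton_iff, mem_inter_iff, mem_iInter, Finset.mem_filter,
      Finset.mem_univ, true_and, mem_compl_iff]
    constructor
    · rintro rfl
      refine ⟨hmem x, fun i hi hxi => hi.not_ge ?_⟩
      exact Finset.min'_le _ _ (by simpa using hxi)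
    · rintro ⟨h1, h2⟩
      refine le_antisymm (Finset.min'_le _ _ (by simpa using h1)) ?_
      exact not_lt.1 fun h => h2 _ h (hmem x)
  refine ⟨t.card, f, p, ?_, fun c => ?_, fun x => ?_⟩
  · refine measurable_to_countable' fun c => ?_
    rw [hpre]
    exact Metric.isOpen_ball.measurableSet.inter
      (Finset.measurableSet_biInter _ fun i _ => Metric.isOpen_ball.measurableSet.compl)
  · rw [hpre]
    exact null_frontier_inter (hρ2 _)
      (null_frontier_biInter (fun i => by rw [frontier_compl]; exact hρ2 _) _)
  · exact (Metric.mem_ball.1 (hmem x)).trans (hρ1 _).2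

/-- The net is indexed by an initial segment of `ℕ`, and padded arbitrarily, to fit
`SimpleFunc.nearestPtInd`. -/
theorem exists_finite_net (X : Type*) [MetricSpace X] [CompactSpace X] [Nonempty X] {r : ℝ}
    (hr : 0 < r) : ∃ (e : ℕ → X) (N : ℕ), ∀ x, ∃ i ≤ N, dist x (e i) < r := by
  classical
  obtain ⟨t, ht⟩ := isCompact_univ.elim_finite_subcover (fun x : X => Metric.ball x r)
    (fun x => Metric.isOpen_ball) fun x _ => mem_iUnion.2 ⟨x, Metric.mem_ball_self hr⟩
  refine ⟨fun i => if h : i < t.card then t.equivFin.symm ⟨i, h⟩ else Classical.arbitrary X,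
    t.card, fun x => ?_⟩
  obtain ⟨y, hy, hxy⟩ := mem_iUnion₂.1 (ht (mem_univ x))
  refine ⟨t.equivFin ⟨y, hy⟩, (t.equivFin ⟨y, hy⟩).2.le, ?_⟩
  simpa using hxy

variable {k : ℕ} {X : Type u} [MetricSpace X]

theorem lintegral_comp_fintype {Ω S : Type*} [MeasurableSpace Ω] [Fintype S] [MeasurableSpace S]
    [MeasurableSingletonClass S] {P : Measure Ω} {U : Ω → S} (hU : Measurable U) (h : S → ℝ≥0∞) :
    ∫⁻ ω, h (U ω) ∂P = ∑ c, h c * P (U ⁻¹' {c}) := by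
  rw [← lintegral_map (f := h) (measurable_of_countable _) hU, lintegral_fintype]
  exact Finset.sum_congr rfl fun c _ => by rw [Measure.map_apply hU (measurableSet_singleton c)]

variable [AddAction (Fin k → ℝ) X]

theorem pathDist_ne_top [CompactSpace X] {L : ℝ} (hL : 0 < L) (x y : X) :
    pathDist (halfOpenCube k L) x y ≠ ∞ := by
  refine ne_top_of_le_ne_top (b := Metric.ediam (univ : Set X) * volume (halfOpenCube k L)) ?_ ?_
  · rw [volume_halfOpenCube k hL.le]
    exact ENNReal.mul_ne_top isCompact_univ.isBounded.ediam_ne_top ENNReal.ofReal_ne_top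
  · rw [← setLIntegral_const]
    exact lintegral_mono fun v => Metric.edist_le_ediam_of_mem (mem_univ _) (mem_univ _)

variable [CompactSpace X] [ContinuousVAdd (Fin k → ℝ) X]

/-- The orbit of `x` as an element of `L¹(A, X)`. -/
noncomputable def orbitPath (A : Set (Fin k → ℝ)) (x : X) : L1Space A X :=
  AEEqFun.mk (μ := volume.restrict A) (fun v => v +ᵥ x)
    (continuous_id.vadd continuous_const).aestronglyMeasurable

theorem rep_orbitPath (A : Set (Fin k → ℝ)) (x : X) :
    (orbitPath A x).rep =ᵐ[volume.restrict A] fun v => v +ᵥ x :=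
  AEEqFun.coeFn_mk (μ := volume.restrict A) _ _

theorem edist_orbitPath (A : Set (Fin k → ℝ)) (x : X) (f : L1Space A X) :
    edist (orbitPath A x) f = ∫⁻ v in A, edist (v +ᵥ x) (f.rep v) := by
  refine lintegral_congr_ae ?_
  filter_upwards [rep_orbitPath A x] with v hv
  rw [hv]

theorem edist_orbitPath_orbitPath (A : Set (Fin k → ℝ)) (x y : X) :
    edist (orbitPath A x) (orbitPath A y) = pathDist A x y := by
  rw [edist_orbitPath]
  refine lintegral_congr_ae ?_
  filter_upwards [rep_orbitPath A y] with v hv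
  rw [hv]

variable [MeasurableSpace X] [BorelSpace X]

/-- Finite quantization of a coupling: the source is replaced by the index of a cell, and the
reproduction by the index of an orbit. -/
theorem exists_quantization [Nonempty X] (μ : Measure X) [IsFiniteMeasure μ] {L ε : ℝ}
    (hL : 0 < L) (hε : 0 < ε) :
    ∃ (m n : ℕ) (f : X → Fin m) (g : L1Space (halfOpenCube k L) X → Fin n) (o : Fin n → X)
      (D : Fin m → Fin n → ℝ), Measurable f ∧ Measurable g ∧
      (∀ c, μ (frontier (f ⁻¹' {c})) = 0) ∧ (∀ c j, 0 ≤ D c j) ∧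
      (∀ x j, pathDist (halfOpenCube k L) x (o j) ≤ ENNReal.ofReal (D (f x) j)) ∧
      ∀ (Ω : Type u) (_ : MeasurableSpace Ω) (P : Measure Ω) (Z : Ω → X)
        (Y : Ω → L1Space (halfOpenCube k L) X), IsProbabilityMeasure P → Measurable Z →
        Measurable Y →
        ∫⁻ ω, (volume (halfOpenCube k L))⁻¹ *
          (∫⁻ v in halfOpenCube k L, edist (v +ᵥ Z ω) ((Y ω).rep v)) ∂P < ENNReal.ofReal ε →
        ∑ c, ∑ j, P.real ((fun ω => f (Z ω)) ⁻¹' {c} ∩ (fun ω => g (Y ω)) ⁻¹' {j}) * D c j ≤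
          3 * ε * L ^ k := by
  set Q := halfOpenCube k L with hQ
  have hLk : 0 < L ^ k := pow_pos hL k
  -- Quantization costs at most `3γ` plus twice the original distortion, so this `γ` gives the total
  -- `3 ε L^k`.
  obtain ⟨γ, hγ⟩ : ∃ γ, γ = ε * L ^ k / 3 := ⟨_, rfl⟩
  have hγ0 : 0 < γ := by rw [hγ]; positivity
  obtain ⟨r, hr, hclose⟩ := exists_pathDist_le (X := X) (k := k) hL hγ0
  obtain ⟨m, f, p, hf, hfr, hfp⟩ := exists_partition_null_frontier μ hr
  obtain ⟨e, N, he⟩ := exists_finite_net X hr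
  -- `L¹` need not be compact, but a net of orbits suffices: the orbit of `Z` is within `γ` of the
  -- net, so the net orbit nearest to `Y` is at most `γ` farther from `Y` than the orbit of `Z` is.
  let g : L1Space Q X → Fin (N + 1) := fun y =>
    ⟨SimpleFunc.nearestPtInd (fun i => orbitPath Q (e i)) N y,
      Nat.lt_succ_of_le (SimpleFunc.nearestPtInd_le _ _ _)⟩
  have hg : Measurable g := by
    refine measurable_to_countable' fun c => ?_
    have : g ⁻¹' {c} = SimpleFunc.nearestPtInd (fun i => orbitPath Q (e i)) N ⁻¹' {(c : ℕ)} := by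
      ext y
      simp [g, Fin.ext_iff]
    rw [this]
    exact SimpleFunc.measurableSet_fiber _ _
  have hgle : ∀ y, ∀ i ≤ N, edist (orbitPath Q (e (g y))) y ≤ edist (orbitPath Q (e i)) y :=
    fun y i hi => SimpleFunc.edist_nearestPt_le (fun i => orbitPath Q (e i)) y hi
  -- The added `γ` makes `D c j` dominate the distance from every point of cell `c`, not only from
  -- its center `p c`.
  let D : Fin m → Fin (N + 1) → ℝ := fun c j => (pathDist Q (p c) (e j)).toReal + γ
  have hD0 : ∀ c j, 0 ≤ D c j := fun c j => by positivity
  have hD : ∀ c j, ENNReal.ofReal (D c j) = pathDist Q (p c) (e j) + ENNReal.ofReal γ := by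
    intro c j
    rw [ENNReal.ofReal_add ENNReal.toReal_nonneg hγ0.le,
      ENNReal.ofReal_toReal (pathDist_ne_top hL _ _)]
  refine ⟨m, N + 1, f, g, fun j => e j, D, hf, hg, hfr, hD0, fun x j => ?_, ?_⟩
  · rw [hD]
    exact (pathDist_triangle Q x (p (f x)) (e j)).trans
      ((add_le_add (hclose _ _ (hfp x)) le_rfl).trans_eq (add_comm _ _))
  intro Ω _ P Z Y _ hZ hY hdist
  have hpoint : ∀ ω, ENNReal.ofReal (D (f (Z ω)) (g (Y ω))) ≤
      ENNReal.ofReal (3 * γ) + 2 * ∫⁻ v in Q, edist (v +ᵥ Z ω) ((Y ω).rep v) := by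
    intro ω
    obtain ⟨i, hi, hZi⟩ := he (Z ω)
    have h1 : pathDist Q (p (f (Z ω))) (Z ω) ≤ ENNReal.ofReal γ := by
      rw [pathDist_comm]
      exact hclose _ _ (hfp _)
    have h2 : edist (orbitPath Q (e (g (Y ω)))) (Y ω) ≤
        ENNReal.ofReal γ + edist (orbitPath Q (Z ω)) (Y ω) := by
      refine (hgle _ i hi).trans ((edist_triangle _ (orbitPath Q (Z ω)) _).trans ?_)
      rw [edist_orbitPath_orbitPath, pathDist_comm]
      exact add_le_add (hclose _ _ hZi) le_rfl
    have h3 : pathDist Q (Z ω) (e (g (Y ω))) ≤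
        edist (orbitPath Q (Z ω)) (Y ω) + edist (orbitPath Q (e (g (Y ω)))) (Y ω) := by
      rw [← edist_orbitPath_orbitPath, edist_comm (orbitPath Q (e (g (Y ω)))) (Y ω)]
      exact edist_triangle _ _ _
    rw [hD, ← edist_orbitPath]
    have h4 : ENNReal.ofReal (3 * γ) = ENNReal.ofReal γ + ENNReal.ofReal γ + ENNReal.ofReal γ := by
      rw [← ENNReal.ofReal_add hγ0.le hγ0.le, ← ENNReal.ofReal_add (by positivity) hγ0.le]
      congr 1
      ring
    calc pathDist Q (p (f (Z ω))) (e (g (Y ω))) + ENNReal.ofReal γ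
        ≤ (ENNReal.ofReal γ + (edist (orbitPath Q (Z ω)) (Y ω) +
            (ENNReal.ofReal γ + edist (orbitPath Q (Z ω)) (Y ω)))) + ENNReal.ofReal γ := by
          gcongr
          exact (pathDist_triangle Q _ (Z ω) _).trans
            (add_le_add h1 (h3.trans (add_le_add le_rfl h2)))
      _ = _ := by
          rw [h4, two_mul]
          ring
  have hQv : volume Q = ENNReal.ofReal (L ^ k) := volume_halfOpenCube k hL.le
  have hQ0 : volume Q ≠ 0 := by simpa [hQv] using hLk
  have hQt : volume Q ≠ ∞ := by simp [hQv]
  have hint : ∫⁻ ω, ENNReal.ofReal (D (f (Z ω)) (g (Y ω))) ∂P ≤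
      ENNReal.ofReal (3 * ε * L ^ k) := by
    calc ∫⁻ ω, ENNReal.ofReal (D (f (Z ω)) (g (Y ω))) ∂P
        ≤ ∫⁻ ω, (ENNReal.ofReal (3 * γ) +
            2 * ∫⁻ v in Q, edist (v +ᵥ Z ω) ((Y ω).rep v)) ∂P := lintegral_mono hpoint
      _ = ENNReal.ofReal (3 * γ) +
            2 * ∫⁻ ω, (∫⁻ v in Q, edist (v +ᵥ Z ω) ((Y ω).rep v)) ∂P := by
          rw [lintegral_add_left measurable_const, lintegral_const, measure_univ, mul_one,
            lintegral_const_mul' _ _ (by simp)]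
      _ ≤ ENNReal.ofReal (3 * γ) + 2 * (ENNReal.ofReal (L ^ k) * ENNReal.ofReal ε) := by
          gcongr
          rw [lintegral_const_mul' _ _ (ENNReal.inv_ne_top.2 hQ0)] at hdist
          rw [← hQv, ← one_mul (∫⁻ ω, _ ∂P), ← ENNReal.mul_inv_cancel hQ0 hQt, mul_assoc]
          exact mul_le_mul_right hdist.le _
      _ = ENNReal.ofReal (3 * ε * L ^ k) := by
          rw [← ENNReal.ofReal_mul hLk.le, ← ENNReal.ofReal_ofNat 2,
            ← ENNReal.ofReal_mul (by norm_num), ← ENNReal.ofReal_add (by positivity)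
            (by positivity)]
          congr 1
          rw [hγ]
          ring
  have hUV : Measurable fun ω => (f (Z ω), g (Y ω)) := (hf.comp hZ).prodMk (hg.comp hY)
  have hpre : ∀ c j, (fun ω => (f (Z ω), g (Y ω))) ⁻¹' {(c, j)} =
      (fun ω => f (Z ω)) ⁻¹' {c} ∩ (fun ω => g (Y ω)) ⁻¹' {j} := by
    intro c j
    ext ω
    simp
  rw [← ENNReal.ofReal_le_ofReal_iff (by positivity)]
  refine le_trans (le_of_eq ?_) hint
  rw [lintegral_comp_fintype hUV fun cj => ENNReal.ofReal (D cj.1 cj.2), Fintype.sum_prod_type,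
    ENNReal.ofReal_sum_of_nonneg fun c _ => Finset.sum_nonneg fun j _ =>
      mul_nonneg measureReal_nonneg (hD0 c j)]
  refine Finset.sum_congr rfl fun c _ => ?_
  rw [ENNReal.ofReal_sum_of_nonneg fun j _ => mul_nonneg measureReal_nonneg (hD0 c j)]
  refine Finset.sum_congr rfl fun j _ => ?_
  rw [hpre, mul_comm, ENNReal.ofReal_mul (hD0 c j), ofReal_measureReal]

end Discretization

/-! ### Running a block channel on all tiles of a large cube. -/

section TiledChannel

/-- The integral of a function with respect to an averaged measure. -/
theorem lintegral_avgMeasure {k : ℕ} {X : Type u} [MetricSpace X] [CompactSpace X]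
    [MeasurableSpace X] [BorelSpace X] [AddAction (Fin k → ℝ) X] [ContinuousVAdd (Fin k → ℝ) X]
    {L : ℝ} (hL : 0 < L) (ν : Measure X) [SFinite ν] {h : X → ℝ≥0∞} (hh : Measurable h) :
    ∫⁻ v in cube k L, ∫⁻ x, h (v +ᵥ x) ∂ν =
      ENNReal.ofReal (L ^ k) * ∫⁻ x, h x ∂avgMeasure k L ν := by
  have hL0 : ENNReal.ofReal (L ^ k) ≠ 0 := by simpa using pow_pos hL k
  rw [avgMeasure, lintegral_smul_measure, smul_eq_mul, ← mul_assoc,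
    ENNReal.mul_inv_cancel hL0 ENNReal.ofReal_ne_top, one_mul,
    Measure.lintegral_bind (aemeasurable_map_vadd k L ν) hh.aemeasurable]
  refine lintegral_congr fun v => ?_
  rw [lintegral_map hh (continuous_const_vadd v).measurable]

variable {k : ℕ}

/-- The lower corners of the tiles of side `L` in a grid shifted by `u`. -/
def gridPoint {N : ℕ} (L : ℝ) (u : Fin k → ℝ) (z : Fin k → Fin N) : Fin k → ℝ :=
  fun i => u i + L * ((z i : ℕ) : ℝ)

/-- The index of a tile, with values in `ℕ`. -/
def gridEmbedding (k N : ℕ) : (Fin k → Fin N) ↪ (Fin k → ℕ) :=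
  ⟨fun z i => z i, fun _ _ h => funext fun i => Fin.ext (congrFun h i)⟩

@[simp]
theorem gridEmbedding_apply {N : ℕ} (z : Fin k → Fin N) (i : Fin k) :
    gridEmbedding k N z i = z i :=
  rfl

variable {X : Type u} [MetricSpace X] [CompactSpace X] [MeasurableSpace X]
  [BorelSpace X] [AddAction (Fin k → ℝ) X] [ContinuousVAdd (Fin k → ℝ) X]

/-- As `u` runs over one tile and `z` over the grid, the corner `u + L z` sweeps out a cube of side
`L N` inside `[0, L']^k` exactly once. This is how the average defining `μ_n` appears. -/
theorem sum_lintegral_gridPoint_le {N : ℕ} {L L' : ℝ} (hL : 0 < L) (hL' : 0 < L')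
    (hN : L * N ≤ L') (ν : Measure X) [SFinite ν] {h : X → ℝ≥0∞} (hh : Measurable h) :
    ∑ z : Fin k → Fin N, ∫⁻ u in halfOpenCube k L, ∫⁻ x, h (gridPoint L u z +ᵥ x) ∂ν ≤
      ENNReal.ofReal (L' ^ k) * ∫⁻ x, h x ∂avgMeasure k L' ν := by
  rw [← lintegral_avgMeasure hL' ν hh]
  have h1 := sum_setLIntegral_tile_le hL (0 : Fin k → ℝ)
    (Finset.univ.map (gridEmbedding k N)) (E := cube k L') (fun z hz => by
      obtain ⟨z, -, rfl⟩ := Finset.mem_map.1 hz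
      intro w hw i _
      obtain ⟨h1, h2⟩ := mem_tile.1 hw i
      have h3 : ((gridEmbedding k N z i : ℕ) : ℝ) + 1 ≤ N := by
        exact_mod_cast (z i).2
      have h4 : 0 ≤ L * ((gridEmbedding k N z i : ℕ) : ℝ) := by positivity
      have h5 := mul_le_mul_of_nonneg_left h3 hL.le
      simp only [Pi.zero_apply] at h1 h2
      exact ⟨by linarith, by linarith⟩) fun v => ∫⁻ x, h (v +ᵥ x) ∂ν
  rw [Finset.sum_map] at h1
  refine le_trans (le_of_eq (Finset.sum_congr rfl fun z _ => lintegral_congr fun u => ?_)) h1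
  congr 3
  funext x
  congr 2
  funext i
  simp [gridPoint]

/-- If the low distortion events of all shifted tilings have small `ν`-measure, then the relative
entropy and the distortion of the channel `W` cannot both be small on average. -/
theorem le_sum_finKL_add_distortion {m n N : ℕ} {f : X → Fin m} (hf : Measurable f)
    {W D : Fin m → Fin n → ℝ} {q : Fin n → ℝ} (hW0 : ∀ c j, 0 ≤ W c j)
    (hW1 : ∀ c, ∑ j, W c j = 1) (hq0 : ∀ j, 0 ≤ q j) (hq1 : ∑ j, q j = 1)
    (hac : ∀ c j, q j = 0 → W c j = 0) (hD : ∀ c j, 0 ≤ D c j) {b t : ℝ} (hb : 0 ≤ b)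
    (ht : 0 < t) {L L' : ℝ} (hL : 0 < L) (hL' : 0 < L') (hN : L * N ≤ L')
    (ν : Measure X) [IsProbabilityMeasure ν]
    (hG : ∀ u ∈ halfOpenCube k L, ∀ y : (Fin k → Fin N) → Fin n,
      ν.real {x | ∑ z, D (f (gridPoint L u z +ᵥ x)) (y z) < t} ≤ Real.exp (-b)) :
    L ^ k * b ≤ L' ^ k * ∑ c, (finKL (W c) q + b / t * ∑ j, W c j * D c j) *
      (avgMeasure k L' ν).real (f ⁻¹' {c}) + L ^ k := by
  have hν' := isProbabilityMeasure_avgMeasure k hL' ν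
  set Θ : Fin m → ℝ := fun c => finKL (W c) q + b / t * ∑ j, W c j * D c j with hΘ
  have hΘ0 : ∀ c, 0 ≤ Θ c := fun c =>
    add_nonneg (finKL_nonneg (hW0 c) hq0 (hac c) (hW1 c) hq1)
      (mul_nonneg (by positivity) (Finset.sum_nonneg fun j _ => mul_nonneg (hW0 c j) (hD c j)))
  let h : X → ℝ≥0∞ := fun x => ENNReal.ofReal (Θ (f x))
  have hh : Measurable h := (measurable_of_countable fun c => ENNReal.ofReal (Θ c)).comp hf
  have hvadd : ∀ v : Fin k → ℝ, Measurable fun x : X => v +ᵥ x := fun v =>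
    (continuous_const_vadd v).measurable
  have hhv : ∀ v : Fin k → ℝ, Measurable fun x : X => h (v +ᵥ x) := fun v => hh.comp (hvadd v)
  have hGm : ∀ u, ∀ y : (Fin k → Fin N) → Fin n,
      MeasurableSet {x | ∑ z, D (f (gridPoint L u z +ᵥ x)) (y z) < t} := fun u y =>
    measurableSet_lt (Finset.measurable_sum _ fun z _ =>
      (measurable_of_countable fun c => D c (y z)).comp (hf.comp (hvadd _))) measurable_const
  -- For a fixed shift, the finite inequality holds at each `x`. After integration over `ν` its last
  -- term is a `q`-average over `y` of `e^b ν(S_y)`, with `S_y` the low distortion event, hence at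
  -- most 1.
  have hpoint : ∀ u ∈ halfOpenCube k L, ENNReal.ofReal b ≤
      (∑ z : Fin k → Fin N, ∫⁻ x, h (gridPoint L u z +ᵥ x) ∂ν) + 1 := by
    intro u hu
    have hqy : ∀ y : (Fin k → Fin N) → Fin n, 0 ≤ Real.exp b * ∏ z, q (y z) := fun y =>
      mul_nonneg (Real.exp_pos b).le (Finset.prod_nonneg fun z _ => hq0 _)
    have hx : ∀ x, ENNReal.ofReal b ≤ (∑ z : Fin k → Fin N, h (gridPoint L u z +ᵥ x)) +
        ∑ y : (Fin k → Fin N) → Fin n, ENNReal.ofReal (Real.exp b * ∏ z, q (y z)) *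
          {x | ∑ z, D (f (gridPoint L u z +ᵥ x)) (y z) < t}.indicator 1 x := by
      intro x
      have h1 := sum_finKL_add_distortion_ge
        (w := fun z : Fin k → Fin N => W (f (gridPoint L u z +ᵥ x)))
        (D := fun z => D (f (gridPoint L u z +ᵥ x))) (fun z => hW0 _) (fun z => hW1 _) hq0 hq1
        (fun z => hac _) (fun z => hD _) hb ht
      refine (ENNReal.ofReal_le_ofReal h1).trans (ENNReal.ofReal_add_le.trans ?_)
      refine add_le_add (le_of_eq (ENNReal.ofReal_sum_of_nonneg fun z _ => hΘ0 _)) (le_of_eq ?_)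
      rw [Finset.mul_sum, ENNReal.ofReal_sum_of_nonneg]
      · refine Finset.sum_congr rfl fun y _ => ?_
        rw [← mul_assoc, ENNReal.ofReal_mul (hqy y)]
        by_cases hxy : ∑ z, D (f (gridPoint L u z +ᵥ x)) (y z) < t <;> simp [hxy]
      · intro y _
        rw [← mul_assoc]
        exact mul_nonneg (hqy y) (by split_ifs <;> simp)
    calc ENNReal.ofReal b = ∫⁻ _, ENNReal.ofReal b ∂ν := by simp
      _ ≤ ∫⁻ x, ((∑ z : Fin k → Fin N, h (gridPoint L u z +ᵥ x)) +
            ∑ y : (Fin k → Fin N) → Fin n, ENNReal.ofReal (Real.exp b * ∏ z, q (y z)) *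
            {x | ∑ z, D (f (gridPoint L u z +ᵥ x)) (y z) < t}.indicator 1 x) ∂ν :=
          lintegral_mono hx
      _ = (∑ z : Fin k → Fin N, ∫⁻ x, h (gridPoint L u z +ᵥ x) ∂ν) +
            ∑ y : (Fin k → Fin N) → Fin n, ENNReal.ofReal (Real.exp b * ∏ z, q (y z)) *
            ν {x | ∑ z, D (f (gridPoint L u z +ᵥ x)) (y z) < t} := by
          rw [lintegral_add_left (Finset.measurable_sum _ fun z _ => hhv _),
            lintegral_finsetSum _ fun z _ => hhv _,
            lintegral_finsetSum _ fun y _ => (measurable_one.indicator (hGm u y)).const_mul _]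
          congr 1
          refine Finset.sum_congr rfl fun y _ => ?_
          rw [lintegral_const_mul _ (measurable_one.indicator (hGm u y)),
            lintegral_indicator_one (hGm u y)]
      _ ≤ _ := by
          refine add_le_add le_rfl ?_
          calc ∑ y : (Fin k → Fin N) → Fin n, ENNReal.ofReal (Real.exp b * ∏ z, q (y z)) *
                ν {x | ∑ z, D (f (gridPoint L u z +ᵥ x)) (y z) < t}
              ≤ ∑ y : (Fin k → Fin N) → Fin n, ENNReal.ofReal (Real.exp b * ∏ z, q (y z)) *
                ENNReal.ofReal (Real.exp (-b)) := by
                refine Finset.sum_le_sum fun y _ => mul_le_mul_right ?_ _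
                rw [← ofReal_measureReal]
                exact ENNReal.ofReal_le_ofReal (hG u hu y)
            _ = 1 := by
                simp_rw [← ENNReal.ofReal_mul (hqy _)]
                rw [← ENNReal.ofReal_sum_of_nonneg fun y _ =>
                  mul_nonneg (hqy y) (Real.exp_pos _).le, ← Finset.sum_mul, ← Finset.mul_sum,
                  sum_prod_eq_one (w := fun _ => q) fun _ => hq1, mul_one, ← Real.exp_add]
                simp
  have hLk : 0 ≤ L ^ k := (pow_pos hL k).le
  have hLk' : 0 ≤ L' ^ k := (pow_pos hL' k).le
  have hmeas : ∀ z : Fin k → Fin N,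
      Measurable fun u : Fin k → ℝ => ∫⁻ x, h (gridPoint L u z +ᵥ x) ∂ν := by
    intro z
    have hc : Continuous fun p : (Fin k → ℝ) × X => gridPoint L p.1 z +ᵥ p.2 := by
      refine Continuous.vadd ?_ continuous_snd
      exact continuous_pi fun i =>
        ((continuous_apply i).comp continuous_fst).add continuous_const
    exact Measurable.lintegral_prod_right' (hh.comp hc.measurable)
  have hfinal : ENNReal.ofReal (L ^ k * b) ≤ ENNReal.ofReal (L' ^ k * ∑ c, Θ c *
      (avgMeasure k L' ν).real (f ⁻¹' {c}) + L ^ k) := by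
    have hS0 : 0 ≤ ∑ c, Θ c * (avgMeasure k L' ν).real (f ⁻¹' {c}) :=
      Finset.sum_nonneg fun c _ => mul_nonneg (hΘ0 c) measureReal_nonneg
    calc ENNReal.ofReal (L ^ k * b) = ∫⁻ _ in halfOpenCube k L, ENNReal.ofReal b := by
          rw [setLIntegral_const, volume_halfOpenCube k hL.le, mul_comm, ENNReal.ofReal_mul hb]
      _ ≤ ∫⁻ u in halfOpenCube k L,
            ((∑ z : Fin k → Fin N, ∫⁻ x, h (gridPoint L u z +ᵥ x) ∂ν) + 1) :=
          setLIntegral_mono' (measurableSet_halfOpenCube k L) hpoint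
      _ = (∑ z : Fin k → Fin N, ∫⁻ u in halfOpenCube k L,
            ∫⁻ x, h (gridPoint L u z +ᵥ x) ∂ν) + ENNReal.ofReal (L ^ k) := by
          rw [lintegral_add_right _ measurable_const, lintegral_finsetSum _ fun z _ => hmeas z,
            setLIntegral_const, volume_halfOpenCube k hL.le, one_mul]
      _ ≤ ENNReal.ofReal (L' ^ k) * ∫⁻ x, h x ∂avgMeasure k L' ν + ENNReal.ofReal (L ^ k) :=
          add_le_add (sum_lintegral_gridPoint_le hL hL' hN ν hh) le_rfl
      _ = _ := by
          rw [ENNReal.ofReal_add (mul_nonneg hLk' hS0) hLk, ENNReal.ofReal_mul hLk',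
            lintegral_comp_fintype hf fun c => ENNReal.ofReal (Θ c),
            ENNReal.ofReal_sum_of_nonneg fun c _ => mul_nonneg (hΘ0 c) measureReal_nonneg]
          congr 2
          refine Finset.sum_congr rfl fun c _ => ?_
          rw [ENNReal.ofReal_mul (hΘ0 c), ofReal_measureReal]
  have hS0 : 0 ≤ ∑ c, Θ c * (avgMeasure k L' ν).real (f ⁻¹' {c}) :=
    Finset.sum_nonneg fun c _ => mul_nonneg (hΘ0 c) measureReal_nonneg
  exact (ENNReal.ofReal_le_ofReal_iff (add_nonneg (mul_nonneg hLk' hS0) hLk)).1 hfinal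

/-- The measure of a low distortion event of a shifted tiling. -/
theorem measureReal_distortion_lt_le {a : Fin k → ℝ} {C : ℝ} {l : ℕ} (hC : 0 < C)
    (hcomp : ∀ L : ℕ, 0 < L → ∀ x y : X, supDist ((fun v => a + v) '' cube k (L : ℝ)) x y ≤
      C * latticeSupDist k (avgDist k 1) (L + l) x y)
    {L' M : ℝ} (hL' : 0 < L') (hM : 0 < M) (ν : Measure X) [IsFiniteMeasure ν] {δ C' : ℝ}
    (hC' : 0 < C')
    (hν : ∀ A : Set X, MeasurableSet A → diamWrt (supDist (cube k L')) A < δ →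
      ν.real A ≤ (C' * diamWrt (supDist (cube k L')) A) ^ M)
    {s : ℝ} (hs : 0 < s) (hsδ : C * (2 * s) < δ) {L : ℝ} (hL : 0 < L) {N n m : ℕ}
    (hN : L' - 2 * L ≤ L * N) {f : X → Fin m} (hf : Measurable f) {o : Fin n → X}
    {D : Fin m → Fin n → ℝ} (hD : ∀ c j, 0 ≤ D c j)
    (hfD : ∀ x j, pathDist (halfOpenCube k L) x (o j) ≤ ENNReal.ofReal (D (f x) j))
    {t : ℝ} (ht : 0 < t) {u : Fin k → ℝ} (hu : u ∈ halfOpenCube k L)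
    (y : (Fin k → Fin N) → Fin n) :
    ν.real {x | ∑ z, D (f (gridPoint L u z +ᵥ x)) (y z) < t} ≤
      2 ^ (⌈L'⌉₊ + l) ^ k * (coveringNumber (avgDist k 1 : X → X → ℝ) s : ℝ) ^
        (2 * t / s + (((⌈L'⌉₊ + l : ℕ) : ℝ) ^ k -
          ((⌈L'⌉₊ + l - 2 * ⌈2 * L + ‖a‖ + l + 2⌉₊ : ℕ) : ℝ) ^ k)) *
        (C' * (C * (2 * s))) ^ M := by
  have hK := Nat.le_ceil (2 * L + ‖a‖ + l + 2)
  set K := ⌈2 * L + ‖a‖ + l + 2⌉₊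
  have hGm : MeasurableSet {x | ∑ z, D (f (gridPoint L u z +ᵥ x)) (y z) < t} :=
    measurableSet_lt (Finset.measurable_sum _ fun z _ =>
      (measurable_of_countable fun c => D c (y z)).comp
        (hf.comp (continuous_const_vadd _).measurable)) measurable_const
  -- The box `[L, L N)^k` is covered by the tiles for every shift `u`. The margin `K` absorbs the
  -- shift, the translation by `-a`, the extra `l`, and rounding.
  refine measureReal_le_of_pathDist_le hC hcomp hL' hM ν hC' hν hs hsδ rfl
    (E := {w | ∀ i, L ≤ w i ∧ w i < L * N}) (K := K) (fun z hz w hw i => ?_) hGm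
    (by positivity) ?_
  · obtain ⟨h1, h2⟩ := mem_tile.1 hw i
    have h3 : (K : ℝ) ≤ z i := by exact_mod_cast (hz i).1
    have h4 : (z i : ℝ) + K + 1 ≤ ⌈L'⌉₊ + l := by exact_mod_cast (hz i).2
    have h5 := abs_le.1 ((Real.norm_eq_abs _).symm.trans_le (norm_le_pi_norm a i))
    have h6 := Nat.ceil_lt_add_one hL'.le
    simp only [Pi.neg_apply, one_mul] at h1 h2
    have hl : (0 : ℝ) ≤ l := by positivity
    exact ⟨by linarith, by linarith⟩
  · intro x hx x' hx'
    have hcov : {w : Fin k → ℝ | ∀ i, L ≤ w i ∧ w i < L * N} ⊆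
        ⋃ z ∈ Finset.univ.map (gridEmbedding k N), tile L u z := by
      intro w hw
      have hu0 : ∀ i, 0 ≤ u i ∧ u i < L := fun i => hu i (mem_univ i)
      have hz0 : ∀ i, 0 ≤ (w i - u i) / L := fun i =>
        div_nonneg (by linarith [(hw i).1, (hu0 i).2]) hL.le
      have hzN : ∀ i, ⌊(w i - u i) / L⌋₊ < N := fun i => by
        rw [Nat.floor_lt (hz0 i), div_lt_iff₀ hL]
        linarith [(hw i).2, (hu0 i).1]
      refine mem_iUnion₂.2 ⟨gridEmbedding k N fun i => ⟨_, hzN i⟩, Finset.mem_map_of_mem _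
        (Finset.mem_univ _), mem_tile.2 fun i => ?_⟩
      have h1 := Nat.floor_le (hz0 i)
      have h2 := Nat.lt_floor_add_one ((w i - u i) / L)
      rw [le_div_iff₀ hL] at h1
      rw [div_lt_iff₀ hL] at h2
      simp only [gridEmbedding_apply]
      constructor <;> linarith
    -- On each tile `x` and `x'` are compared through the common orbit `o (y z)`. Each contributes
    -- less than `t` in total, hence `2 * t`.
    refine (setLIntegral_le_sum_tile u _ hcov _).trans ?_
    rw [Finset.sum_map]
    have hterm : ∀ z : Fin k → Fin N, ∫⁻ v in halfOpenCube k L,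
        edist ((v + fun i => u i + L * ((gridEmbedding k N z i : ℕ) : ℝ)) +ᵥ x)
          ((v + fun i => u i + L * ((gridEmbedding k N z i : ℕ) : ℝ)) +ᵥ x') ≤
        ENNReal.ofReal (D (f (gridPoint L u z +ᵥ x)) (y z)) +
          ENNReal.ofReal (D (f (gridPoint L u z +ᵥ x')) (y z)) := by
      intro z
      have h1 : ∀ x : X, ∀ v : Fin k → ℝ,
          (v + fun i => u i + L * ((gridEmbedding k N z i : ℕ) : ℝ)) +ᵥ x =
          v +ᵥ (gridPoint L u z +ᵥ x) := fun x v => by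
        rw [vadd_vadd]
        rfl
      simp_rw [h1]
      refine (pathDist_triangle (halfOpenCube k L) (gridPoint L u z +ᵥ x) (o (y z))
        (gridPoint L u z +ᵥ x')).trans (add_le_add (hfD _ _) ?_)
      rw [pathDist_comm]
      exact hfD _ _
    refine (Finset.sum_le_sum fun z _ => hterm z).trans ?_
    rw [Finset.sum_add_distrib, ← ENNReal.ofReal_sum_of_nonneg fun z _ => hD _ _,
      ← ENNReal.ofReal_sum_of_nonneg fun z _ => hD _ _, two_mul, ENNReal.ofReal_add ht.le ht.le]
    exact add_le_add (ENNReal.ofReal_le_ofReal (le_of_lt hx))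
      (ENNReal.ofReal_le_ofReal (le_of_lt hx'))

end TiledChannel

/-! ### Passage to the limit and the bound for the rate. -/

section Asymptotics

theorem tendsto_natCeil_add_sub_div (l K : ℕ) :
    Tendsto (fun x : ℝ => ((⌈x⌉₊ + l - K : ℕ) : ℝ) / x) atTop (𝓝 1) := by
  have h1 : Tendsto (fun x : ℝ => (⌈x⌉₊ : ℝ) / x + ((l : ℝ) - K) / x) atTop (𝓝 (1 + 0)) :=
    (tendsto_nat_ceil_div_atTop (R := ℝ)).add (tendsto_const_nhds.div_atTop tendsto_id)
  rw [add_zero] at h1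
  refine h1.congr' ?_
  filter_upwards [eventually_ge_atTop (K : ℝ)] with x hx
  have hK : K ≤ ⌈x⌉₊ + l := by
    have : (K : ℝ) ≤ ⌈x⌉₊ := hx.trans (Nat.le_ceil x)
    have : K ≤ ⌈x⌉₊ := by exact_mod_cast this
    omega
  rw [Nat.cast_sub hK, Nat.cast_add]
  ring

theorem tendsto_div_natFloor_sub_one {L : ℝ} (hL : 0 < L) :
    Tendsto (fun x : ℝ => x / ((⌊x / L⌋₊ - 1 : ℕ) : ℝ)) atTop (𝓝 L) := by
  have hdiv : Tendsto (fun x : ℝ => x / L) atTop atTop := tendsto_id.atTop_div_const hL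
  have h1 : Tendsto (fun x : ℝ => (⌊x⌋₊ : ℝ) / x - 1 / x) atTop (𝓝 (1 - 0)) :=
    (tendsto_nat_floor_div_atTop (R := ℝ)).sub (tendsto_const_nhds.div_atTop tendsto_id)
  have h2 : Tendsto (fun x : ℝ => L * ((⌊x / L⌋₊ : ℝ) / (x / L) - 1 / (x / L))⁻¹) atTop
      (𝓝 (L * (1 - 0)⁻¹)) := ((h1.comp hdiv).inv₀ (by norm_num)).const_mul L
  rw [sub_zero, inv_one, mul_one] at h2
  refine h2.congr' ?_
  filter_upwards [eventually_ge_atTop L] with x hx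
  have hx0 : 0 < x := hL.trans_le hx
  have hf : 1 ≤ ⌊x / L⌋₊ := by
    rw [Nat.one_le_floor_iff, le_div_iff₀ hL]
    linarith
  rw [Nat.cast_sub hf, Nat.cast_one, ← sub_div, inv_div]
  field_simp

theorem natFloor_tiles {L x : ℝ} (hL : 0 < L) (hx : 2 * L ≤ x) :
    1 ≤ ⌊x / L⌋₊ - 1 ∧ L * ((⌊x / L⌋₊ - 1 : ℕ) : ℝ) ≤ x ∧
      x - 2 * L ≤ L * ((⌊x / L⌋₊ - 1 : ℕ) : ℝ) := by
  have h2 : 2 ≤ ⌊x / L⌋₊ := by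
    refine Nat.le_floor ?_
    rw [le_div_iff₀ hL]
    exact_mod_cast hx
  have h3 := Nat.floor_le (div_nonneg (by linarith) hL.le : 0 ≤ x / L)
  have h4 := Nat.lt_floor_add_one (x / L)
  rw [le_div_iff₀ hL] at h3
  rw [div_lt_iff₀ hL] at h4
  rw [Nat.cast_sub (by omega), Nat.cast_one]
  exact ⟨by omega, by linarith, by linarith⟩

variable {k : ℕ} {X : Type u} [MetricSpace X] [CompactSpace X] [MeasurableSpace X]
  [BorelSpace X] [AddAction (Fin k → ℝ) X] [ContinuousVAdd (Fin k → ℝ) X]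

/-- A lower bound for the relative entropy and the distortion of a finite channel, with respect to
a limit of averaged measures. -/
theorem le_finKL_add_distortion_limit (hk : 0 < k) {a : Fin k → ℝ} {C : ℝ} {l : ℕ} (hC : 0 < C)
    (hcomp : ∀ L : ℕ, 0 < L → ∀ x y : X, supDist ((fun v => a + v) '' cube k (L : ℝ)) x y ≤
      C * latticeSupDist k (avgDist k 1) (L + l) x y)
    {L' M : ℕ → ℝ} (hL' : ∀ n, 0 < L' n) (hM : ∀ n, 0 < M n) (hLtop : Tendsto L' atTop atTop)
    {ν : ℕ → ProbabilityMeasure X} {δ C' : ℝ} (hC' : 0 < C')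
    (hν : ∀ (n : ℕ) (A : Set X), MeasurableSet A → diamWrt (supDist (cube k (L' n))) A < δ →
      (ν n : Measure X).real A ≤ (C' * diamWrt (supDist (cube k (L' n))) A) ^ M n)
    {μ : ProbabilityMeasure X} (hμ : Tendsto (fun n => avgProb k (hL' n) (ν n)) atTop (𝓝 μ))
    {c : ℝ} (hfreq : ∃ᶠ n in atTop, c < M n / L' n ^ k)
    {s : ℝ} (hs : 0 < s) (hsδ : C * (2 * s) < δ) (hs1 : C' * (C * (2 * s)) < 1)
    {β : ℝ} (hβ : β = c * -Real.log (C' * (C * (2 * s))) - 3) (hβ0 : 0 ≤ β)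
    {L κ : ℝ} (hL : 0 < L) (hκ : 0 < κ)
    (hR : 2 * κ / (s * L ^ k) *
      Real.log (coveringNumber (avgDist k 1 : X → X → ℝ) s : ℝ) ≤ 1 / 2)
    {m n : ℕ} {f : X → Fin m} (hf : Measurable f)
    (hfr : ∀ c, (μ : Measure X) (frontier (f ⁻¹' {c})) = 0) {o : Fin n → X}
    {W D : Fin m → Fin n → ℝ} {q : Fin n → ℝ} (hW0 : ∀ c j, 0 ≤ W c j)
    (hW1 : ∀ c, ∑ j, W c j = 1) (hq0 : ∀ j, 0 ≤ q j) (hq1 : ∑ j, q j = 1)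
    (hac : ∀ c j, q j = 0 → W c j = 0) (hD : ∀ c j, 0 ≤ D c j)
    (hfD : ∀ x j, pathDist (halfOpenCube k L) x (o j) ≤ ENNReal.ofReal (D (f x) j)) :
    L ^ k * β ≤ ∑ c, (finKL (W c) q + β / κ * L ^ k * ∑ j, W c j * D c j) *
      (μ : Measure X).real (f ⁻¹' {c}) := by
  have : Nonempty X := μ.nonempty
  have hLk : 0 < L ^ k := pow_pos hL k
  have hLk' : ∀ n, 0 < L' n ^ k := fun n => pow_pos (hL' n) k
  have hR1 : (1 : ℝ) ≤ (coveringNumber (avgDist k 1 : X → X → ℝ) s : ℝ) := by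
    exact_mod_cast one_le_coveringNumber (X := X) (k := k) hs
  set R : ℝ := (coveringNumber (avgDist k 1 : X → X → ℝ) s : ℝ) with hRdef
  have hlogR : 0 ≤ Real.log R := Real.log_nonneg hR1
  set r : ℝ := C' * (C * (2 * s)) with hr
  have hr0 : 0 < r := by positivity
  have hlogr : Real.log r < 0 := Real.log_neg hr0 hs1
  set K : ℕ := 2 * ⌈2 * L + ‖a‖ + l + 2⌉₊ with hK
  have hN : ∀ K : ℕ, Tendsto (fun n => ((⌈L' n⌉₊ + l - K : ℕ) : ℝ) ^ k / L' n ^ k) atTop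
      (𝓝 1) := by
    intro K
    have h := ((tendsto_natCeil_add_sub_div l K).comp hLtop).pow k
    rw [one_pow] at h
    exact h.congr fun n => div_pow _ _ _
  have hN0 : Tendsto (fun n => ((⌈L' n⌉₊ + l : ℕ) : ℝ) ^ k / L' n ^ k) atTop (𝓝 1) := hN 0
  have hT : Tendsto (fun n => L' n ^ k / ((⌊L' n / L⌋₊ - 1 : ℕ) : ℝ) ^ k) atTop (𝓝 (L ^ k)) :=
    (((tendsto_div_natFloor_sub_one hL).comp hLtop).pow k).congr fun n => div_pow _ _ _
  have hgap : Tendsto (fun n => Real.log R * (((⌈L' n⌉₊ + l : ℕ) : ℝ) ^ k / L' n ^ k -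
      ((⌈L' n⌉₊ + l - K : ℕ) : ℝ) ^ k / L' n ^ k)) atTop (𝓝 (Real.log R * (1 - 1))) :=
    (hN0.sub (hN K)).const_mul _
  have hμc : ∀ c, Tendsto (fun n => (avgMeasure k (L' n) (ν n : Measure X)).real (f ⁻¹' {c})) atTop
      (𝓝 ((μ : Measure X).real (f ⁻¹' {c}))) := by
    intro c
    have h := ProbabilityMeasure.tendsto_measure_of_null_frontier_of_tendsto hμ
      (E := f ⁻¹' {c}) (by simpa using hfr c)
    exact (NNReal.tendsto_coe.2 h)
  -- The parameters are `b = β L_n^k` and `t = κ T^k`, where `T` is the number of tiles per side.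
  -- Since `L_n / T → L`, the ratio `b / t` tends to `β / κ * L^k`.
  have hlim : Tendsto (fun n => ∑ c, (finKL (W c) q + β / κ *
      (L' n ^ k / ((⌊L' n / L⌋₊ - 1 : ℕ) : ℝ) ^ k) * ∑ j, W c j * D c j) *
      (avgMeasure k (L' n) (ν n : Measure X)).real (f ⁻¹' {c}) + L ^ k / L' n ^ k) atTop
      (𝓝 (∑ c, (finKL (W c) q + β / κ * L ^ k * ∑ j, W c j * D c j) *
        (μ : Measure X).real (f ⁻¹' {c}) + 0)) := by
    refine Tendsto.add (tendsto_finsetSum _ fun c _ => Tendsto.mul ?_ (hμc c)) ?_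
    · exact ((hT.const_mul _).mul_const _).const_add _
    · exact tendsto_const_nhds.div_atTop ((tendsto_pow_atTop hk.ne').comp hLtop)
  rw [add_zero] at hlim
  have hev1 := hN0.eventually_le_const one_lt_two
  have hev2 := hgap.eventually_le_const (show Real.log R * (1 - 1) < 1 / 2 by norm_num)
  -- The lower bound on `M n / L' n ^ k` is known only for infinitely many `n`; as the right side
  -- converges, that is enough.
  refine ge_of_tendsto_of_frequently hlim ?_
  refine (hfreq.and_eventually (hev1.and (hev2.and
    (hLtop.eventually_ge_atTop (2 * L))))).mono ?_
  rintro n ⟨hMn, h1, h2, h3⟩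
  obtain ⟨hT1, hT2, hT3⟩ := natFloor_tiles hL h3
  set T : ℕ := ⌊L' n / L⌋₊ - 1 with hTdef
  have hT0 : 0 < (T : ℝ) ^ k := pow_pos (by exact_mod_cast hT1) k
  have ht : 0 < κ * (T : ℝ) ^ k := mul_pos hκ hT0
  have hb : 0 ≤ β * L' n ^ k := mul_nonneg hβ0 (hLk' n).le
  have hmain := le_sum_finKL_add_distortion (k := k) hf hW0 hW1 hq0 hq1 hac hD hb ht hL (hL' n) hT2
    (ν n : Measure X) ?_
  · have h4 : β * L' n ^ k / (κ * (T : ℝ) ^ k) = β / κ * (L' n ^ k / (T : ℝ) ^ k) := by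
      field_simp
    rw [h4] at hmain
    refine le_of_mul_le_mul_left ?_ (hLk' n)
    rw [mul_add, mul_div_cancel₀ _ (hLk' n).ne']
    linarith
  · intro u hu y
    refine (measureReal_distortion_lt_le hC hcomp (hL' n) (hM n) (ν n : Measure X) hC' (hν n) hs
      hsδ hL hT3 hf hD hfD ht hu y).trans ?_
    rw [← hRdef, ← hr, ← Real.rpow_natCast 2, Real.rpow_def_of_pos (zero_lt_two),
      Real.rpow_def_of_pos (zero_lt_one.trans_le hR1), Real.rpow_def_of_pos hr0, ← Real.exp_add,
      ← Real.exp_add, Real.exp_le_exp, ← hK]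
    push_cast only [Nat.cast_pow]
    rw [lt_div_iff₀ (hLk' n)] at hMn
    rw [div_le_iff₀ (hLk' n)] at h1
    rw [← sub_div, mul_div_assoc', div_le_iff₀ (hLk' n)] at h2
    have hlog2 : Real.log 2 ≤ 1 := by
      have := Real.log_two_lt_d9
      linarith
    -- The 3 in `β` is spent here, per unit of `L' n ^ k`: 2 on the choice of exceptional times, 1/2
    -- on the covers at interior times (`e2`), and 1/2 on boundary times (`h2`).
    have e1 : Real.log 2 * ((⌈L' n⌉₊ + l : ℕ) : ℝ) ^ k ≤ 2 * L' n ^ k := by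
      have h5 : 0 ≤ ((⌈L' n⌉₊ + l : ℕ) : ℝ) ^ k := by positivity
      have h6 := mul_le_mul_of_nonneg_right hlog2 h5
      linarith
    have e2 : Real.log R * (2 * (κ * (T : ℝ) ^ k) / s) ≤ 1 / 2 * L' n ^ k := by
      have h5 : (L * (T : ℝ)) ^ k ≤ L' n ^ k := pow_le_pow_left₀ (by positivity) hT2 k
      rw [mul_pow] at h5
      have h6 : 0 ≤ 2 * κ / (s * L ^ k) * Real.log R := by positivity
      calc Real.log R * (2 * (κ * (T : ℝ) ^ k) / s)
          = 2 * κ / (s * L ^ k) * Real.log R * (L ^ k * (T : ℝ) ^ k) := by field_simp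
        _ ≤ 2 * κ / (s * L ^ k) * Real.log R * L' n ^ k := mul_le_mul_of_nonneg_left h5 h6
        _ ≤ _ := mul_le_mul_of_nonneg_right hR (hLk' n).le
    have e3 : Real.log r * M n ≤ Real.log r * (c * L' n ^ k) :=
      mul_le_mul_of_nonpos_left hMn.le hlogr.le
    rw [hβ, mul_add]
    linarith

/-- A lower bound for the rate of a block. -/
theorem ofReal_le_rateOn (hk : 0 < k) {a : Fin k → ℝ} {C : ℝ} {l : ℕ} (hC : 0 < C)
    (hcomp : ∀ L : ℕ, 0 < L → ∀ x y : X, supDist ((fun v => a + v) '' cube k (L : ℝ)) x y ≤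
      C * latticeSupDist k (avgDist k 1) (L + l) x y)
    {L' M : ℕ → ℝ} (hL' : ∀ n, 0 < L' n) (hM : ∀ n, 0 < M n) (hLtop : Tendsto L' atTop atTop)
    {ν : ℕ → ProbabilityMeasure X} {δ C' : ℝ} (hC' : 0 < C')
    (hν : ∀ (n : ℕ) (A : Set X), MeasurableSet A → diamWrt (supDist (cube k (L' n))) A < δ →
      (ν n : Measure X).real A ≤ (C' * diamWrt (supDist (cube k (L' n))) A) ^ M n)
    {μ : ProbabilityMeasure X} (hμ : Tendsto (fun n => avgProb k (hL' n) (ν n)) atTop (𝓝 μ))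
    {c : ℝ} (hfreq : ∃ᶠ n in atTop, c < M n / L' n ^ k)
    {s : ℝ} (hs : 0 < s) (hsδ : C * (2 * s) < δ) (hs1 : C' * (C * (2 * s)) < 1)
    {β : ℝ} (hβ : β = c * -Real.log (C' * (C * (2 * s))) - 3) (hβ0 : 0 ≤ β)
    {L ε η : ℝ} (hL : 0 < L) (hε : 0 < ε) (hη : 0 < η)
    (hR : 6 * ε / (η * s) * Real.log (coveringNumber (avgDist k 1 : X → X → ℝ) s : ℝ) ≤ 1 / 2) :
    ENNReal.ofReal ((1 - η) * β / Real.log 2 * L ^ k) ≤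
      rateOn (μ : Measure X) ε (halfOpenCube k L) := by
  have : Nonempty X := μ.nonempty
  have hLk : 0 < L ^ k := pow_pos hL k
  have hlog2 : 0 < Real.log 2 := Real.log_pos one_lt_two
  refine le_sInf ?_
  rintro _ ⟨Ω, _, P, Z, Y, hP, hZ, hY, hPZ, hdist, rfl⟩
  obtain ⟨m, n, f, g, o, D, hf, hg, hfr, hD, hfD, hq⟩ :=
    exists_quantization (k := k) (μ : Measure X) hL hε
  have hED := hq Ω _ P Z Y hP hZ hY hdist
  have hU : Measurable fun ω => f (Z ω) := hf.comp hZ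
  have hV : Measurable fun ω => g (Y ω) := hg.comp hY
  have hI : ENNReal.ofReal (finiteMutualInfo P (fun ω => f (Z ω)) fun ω => g (Y ω)) ≤
      mutualInfo P Z Y :=
    le_iSup_of_le m <| le_iSup_of_le n <| le_iSup_of_le f <| le_iSup_of_le g <|
      le_iSup_of_le hf <| le_iSup_of_le hg le_rfl
  refine le_trans (ENNReal.ofReal_le_ofReal ?_) hI
  have hmain := le_finKL_add_distortion_limit hk hC hcomp hL' hM hLtop hC' hν hμ hfreq hs hsδ hs1
    -- With expected distortion at most `3 ε L^k`, this `κ` makes the distortion term cost only the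
    -- fraction `η` of the bound `β L^k`.
    hβ hβ0 hL (κ := 3 * ε * L ^ k / η) (by positivity) (by
      refine le_trans (le_of_eq ?_) hR
      field_simp
      ring) hf hfr (fun c j => condLaw_nonneg (P := P) (U := fun ω => f (Z ω))
        (V := fun ω => g (Y ω)) c j) (sum_condLaw hU hV) (fun j => measureReal_nonneg)
      (sum_preimage_real (P := P) hV) condLaw_eq_zero hD hfD
  have hμP : ∀ c, (μ : Measure X).real (f ⁻¹' {c}) = P.real ((fun ω => f (Z ω)) ⁻¹' {c}) := by
    intro c
    rw [← hPZ, map_measureReal_apply hZ (hf (measurableSet_singleton c))]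
    rfl
  have hMI := log_two_mul_finiteMutualInfo (P := P) hU hV
  have hsum : ∑ c, (finKL (condLaw P (fun ω => f (Z ω)) (fun ω => g (Y ω)) c)
        (fun j => P.real ((fun ω => g (Y ω)) ⁻¹' {j})) + β / (3 * ε * L ^ k / η) * L ^ k *
        ∑ j, condLaw P (fun ω => f (Z ω)) (fun ω => g (Y ω)) c j * D c j) *
        (μ : Measure X).real (f ⁻¹' {c}) =
      Real.log 2 * finiteMutualInfo P (fun ω => f (Z ω)) (fun ω => g (Y ω)) +
        β / (3 * ε * L ^ k / η) * L ^ k * ∑ c, ∑ j,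
        P.real ((fun ω => f (Z ω)) ⁻¹' {c} ∩ (fun ω => g (Y ω)) ⁻¹' {j}) * D c j := by
    rw [hMI, Finset.mul_sum, ← Finset.sum_add_distrib]
    refine Finset.sum_congr rfl fun c _ => ?_
    simp_rw [← real_mul_condLaw, mul_assoc, ← Finset.mul_sum, hμP]
    ring
  rw [hsum] at hmain
  have h1 : β / (3 * ε * L ^ k / η) * L ^ k * ∑ c, ∑ j,
      P.real ((fun ω => f (Z ω)) ⁻¹' {c} ∩ (fun ω => g (Y ω)) ⁻¹' {j}) * D c j ≤
      β / (3 * ε * L ^ k / η) * L ^ k * (3 * ε * L ^ k) :=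
    mul_le_mul_of_nonneg_left hED (by positivity)
  have h2 : β / (3 * ε * L ^ k / η) * L ^ k * (3 * ε * L ^ k) = η * β * L ^ k := by
    field_simp
  rw [div_mul_eq_mul_div, div_le_iff₀ hlog2]
  linarith

end Asymptotics

/-! ### Choice of scales and conclusion. -/

/-- For small `ε` and `s = ε ^ (1 - η)` all conditions on the scale `s` are satisfied. -/
theorem eventually_scale {cov : ℝ → ℕ} {c d C C' δ η : ℝ}
    (hcov : ∀ δ : ℝ, 0 < δ →
      Tendsto (fun ε : ℝ => ε ^ δ * Real.logb 2 (cov ε : ℝ)) (𝓝[>] 0) (𝓝 0))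
    (hC : 0 < C) (hC' : 0 < C') (hδ : 0 < δ) (hη : 0 < η) (hη1 : η < 1) (hd : 0 ≤ d)
    (hdc : d < (1 - η) * (c * (1 - η))) :
    ∀ᶠ ε : ℝ in 𝓝[>] 0, 0 < ε ∧ ε < 1 ∧ C * (2 * ε ^ (1 - η)) < δ ∧
      C' * (C * (2 * ε ^ (1 - η))) < 1 ∧
      0 ≤ c * -Real.log (C' * (C * (2 * ε ^ (1 - η)))) - 3 ∧
      d * -Real.log ε ≤ (1 - η) * (c * -Real.log (C' * (C * (2 * ε ^ (1 - η)))) - 3) ∧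
      6 * ε / (η * ε ^ (1 - η)) * Real.log (cov (ε ^ (1 - η)) : ℝ) ≤ 1 / 2 := by
  have hη' : 0 < 1 - η := by linarith
  have hs : Tendsto (fun ε : ℝ => ε ^ (1 - η)) (𝓝[>] 0) (𝓝 0) := by
    have h := (Real.continuousAt_rpow_const 0 (1 - η) (Or.inr hη'.le)).tendsto
    rw [Real.zero_rpow hη'.ne'] at h
    exact h.mono_left nhdsWithin_le_nhds
  have hs' : Tendsto (fun ε : ℝ => ε ^ (1 - η)) (𝓝[>] 0) (𝓝[>] 0) := by
    refine tendsto_nhdsWithin_iff.2 ⟨hs, ?_⟩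
    filter_upwards [self_mem_nhdsWithin] with ε hε
    exact Real.rpow_pos_of_pos hε _
  have hx : Tendsto (fun ε : ℝ => -Real.log ε) (𝓝[>] 0) atTop :=
    tendsto_neg_atBot_atTop.comp Real.tendsto_log_nhdsGT_zero
  have e1 : ∀ᶠ ε : ℝ in 𝓝[>] 0, C * (2 * ε ^ (1 - η)) < δ := by
    have h : Tendsto (fun ε : ℝ => C * (2 * ε ^ (1 - η))) (𝓝[>] 0) (𝓝 (C * (2 * 0))) :=
      (hs.const_mul 2).const_mul C
    exact h.eventually_lt_const (by simpa using hδ)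
  have e2 : ∀ᶠ ε : ℝ in 𝓝[>] 0, C' * (C * (2 * ε ^ (1 - η))) < 1 := by
    have h : Tendsto (fun ε : ℝ => C' * (C * (2 * ε ^ (1 - η)))) (𝓝[>] 0)
      (𝓝 (C' * (C * (2 * 0)))) := ((hs.const_mul 2).const_mul C).const_mul C'
    exact h.eventually_lt_const (by simp)
  have e3 : ∀ᶠ ε : ℝ in 𝓝[>] 0,
      6 * ε / (η * ε ^ (1 - η)) * Real.log (cov (ε ^ (1 - η)) : ℝ) ≤ 1 / 2 := by
    -- Since `ε / s = ε^η = s^(η / (1 - η))`, tame growth is needed with exactly this exponent.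
    have h := ((hcov (η / (1 - η)) (by positivity)).comp hs').const_mul (6 * Real.log 2 / η)
    rw [mul_zero] at h
    filter_upwards [h.eventually_le_const (by norm_num : (0 : ℝ) < 1 / 2), self_mem_nhdsWithin]
      with ε h hε
    have hε0 : 0 < ε := hε
    refine le_trans (le_of_eq ?_) h
    have h1 : (ε ^ (1 - η)) ^ (η / (1 - η)) = ε ^ η := by
      rw [← Real.rpow_mul hε0.le, mul_div_cancel₀ _ hη'.ne']
    have h2 : ε = ε ^ (1 - η) * ε ^ η := by
      rw [← Real.rpow_add hε0, sub_add_cancel, Real.rpow_one]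
    have h3 : 0 < ε ^ (1 - η) := Real.rpow_pos_of_pos hε0 _
    have h4 : Real.log 2 ≠ 0 := (Real.log_pos one_lt_two).ne'
    have h5 : 6 * ε / (η * ε ^ (1 - η)) = 6 / η * ε ^ η := by
      nth_rewrite 1 [h2]
      field_simp
    simp only [Function.comp_apply]
    rw [h1, h5, Real.logb]
    field_simp
  obtain ⟨A, hA⟩ : ∃ A, A = c * Real.log (C' * (C * 2)) + 3 := ⟨_, rfl⟩
  have hlog : ∀ ε : ℝ, 0 < ε → c * -Real.log (C' * (C * (2 * ε ^ (1 - η)))) - 3 =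
      c * (1 - η) * -Real.log ε - A := by
    intro ε hε
    have h3 : 0 < ε ^ (1 - η) := Real.rpow_pos_of_pos hε _
    rw [show C' * (C * (2 * ε ^ (1 - η))) = C' * (C * 2) * ε ^ (1 - η) by ring,
      Real.log_mul (by positivity) h3.ne', Real.log_rpow hε, hA]
    ring
  have hc0 : 0 < c * (1 - η) := by
    by_contra h
    have := mul_nonpos_of_nonneg_of_nonpos hη'.le (not_lt.1 h)
    linarith
  have e4 := (hx.const_mul_atTop hc0).eventually_ge_atTop A
  have e5 := (hx.const_mul_atTop (sub_pos.2 hdc)).eventually_ge_atTop ((1 - η) * A)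
  filter_upwards [e1, e2, e3, e4, e5, self_mem_nhdsWithin, Ioo_mem_nhdsGT one_pos]
    with ε h1 h2 h3 h4 h5 h6 h7
  refine ⟨h6, h7.2, h1, h2, ?_, ?_, h3⟩
  · rw [hlog ε h6]
    linarith
  · rw [hlog ε h6]
    linarith

end RateDistortion

theorem mainTheorem6
    (k : ℕ) (hk : 0 < k)
    (X : Type u) [MetricSpace X] [CompactSpace X] [MeasurableSpace X] [BorelSpace X]
    [AddAction (Fin k → ℝ) X] [ContinuousVAdd (Fin k → ℝ) X]
    (hTame : RateDistortion.TameGrowth (RateDistortion.avgDist k 1 : X → X → ℝ))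
    (hComp : ∃ (a : Fin k → ℝ) (C : ℝ) (l : ℕ), 0 < C ∧
      ∀ L : ℕ, 0 < L → ∀ x y : X,
        RateDistortion.supDist ((fun v => a + v) '' RateDistortion.cube k (L : ℝ)) x y ≤
          C * RateDistortion.latticeSupDist k (RateDistortion.avgDist k 1) (L + l) x y)
    (L M : ℕ → ℝ) (hL : ∀ n, 0 < L n) (hM : ∀ n, 0 < M n) (hLtop : Tendsto L atTop atTop)
    (ν : ℕ → ProbabilityMeasure X)
    (hν : ∃ δ C' : ℝ, 0 < δ ∧ 0 < C' ∧ ∀ (n : ℕ) (A : Set X), MeasurableSet A →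
      RateDistortion.diamWrt (RateDistortion.supDist (RateDistortion.cube k (L n))) A < δ →
      (ν n : Measure X).real A ≤
        (C' * RateDistortion.diamWrt
          (RateDistortion.supDist (RateDistortion.cube k (L n))) A) ^ M n)
    (μ : ProbabilityMeasure X) [VAddInvariantMeasure (Fin k → ℝ) X (μ : Measure X)]
    (hμ : Tendsto (fun n => RateDistortion.avgProb k (hL n) (ν n)) atTop (𝓝 μ)) :
    limsup (fun n => ENNReal.ofReal (M n / L n ^ k)) atTop ≤
      RateDistortion.lowerRateDistortionDim k (μ : Measure X) := by
  obtain ⟨a, C, l, hC, hcomp⟩ := hComp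
  obtain ⟨δ, C', hδ, hC', hν⟩ := hν
  refine le_of_forall_lt_imp_le_of_dense fun z hz => ?_
  obtain ⟨z', hzz', hz'⟩ := exists_between hz
  have hz't : z' ≠ ∞ := (hz'.trans_le le_top).ne
  have hzt : z ≠ ∞ := (hzz'.trans_le le_top).ne
  set c := z'.toReal with hc
  set d := z.toReal with hd
  have hd0 : 0 ≤ d := ENNReal.toReal_nonneg
  have hdc : d < c := (ENNReal.toReal_lt_toReal hzt hz't).2 hzz'
  have hc0 : 0 < c := hd0.trans_lt hdc
  have hfreq : ∃ᶠ n in atTop, c < M n / L n ^ k := by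
    refine (frequently_lt_of_lt_limsup (h := hz')).mono fun n hn => ?_
    exact (ENNReal.lt_ofReal_iff_toReal_lt hz't).1 hn
  -- The argument loses two factors `1 - η`, one from the distortion and one from the scale `s`.
  -- This `η` gives `(1 - η)^2 c > c - 2ηc = (c + d) / 2 > d`.
  obtain ⟨η, hη⟩ : ∃ η, η = (c - d) / (4 * c) := ⟨_, rfl⟩
  have hηc : η * c = (c - d) / 4 := by
    rw [hη]
    field_simp
  have hη0 : 0 < η := by
    rw [hη]
    exact div_pos (sub_pos.2 hdc) (by positivity)
  have hη1 : η < 1 := by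
    rw [hη, div_lt_one (by positivity)]
    linarith
  have hdη : d < (1 - η) * (c * (1 - η)) := by
    nlinarith [mul_pos hη0 (mul_pos hη0 hc0)]
  refine le_liminf_of_le (by isBoundedDefault) ?_
  filter_upwards [RateDistortion.eventually_scale hTame hC hC' hδ hη0 hη1 hd0 hdη]
    with ε ⟨hε0, hε1, h1, h2, h3, h4, h5⟩
  have hlog2 : 0 < Real.log 2 := Real.log_pos one_lt_two
  have hlogε : 0 < -Real.log ε := neg_pos.2 (Real.log_neg hε0 hε1)
  have hlogb : Real.logb 2 (1 / ε) = -Real.log ε / Real.log 2 := by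
    rw [one_div, Real.logb, Real.log_inv]
  have hlogb0 : 0 < Real.logb 2 (1 / ε) := by
    rw [hlogb]
    positivity
  rw [ENNReal.le_div_iff_mul_le (Or.inl (by simpa using hlogb0)) (Or.inl ENNReal.ofReal_ne_top),
    ← ENNReal.ofReal_toReal hzt, ← hd, ← ENNReal.ofReal_mul hd0]
  refine le_liminf_of_le (by isBoundedDefault) ?_
  filter_upwards [eventually_gt_atTop 0] with L₀ hL₀
  have hLk : 0 < L₀ ^ k := pow_pos hL₀ k
  rw [ENNReal.le_div_iff_mul_le (Or.inl (by simpa using hLk)) (Or.inl ENNReal.ofReal_ne_top),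
    ← ENNReal.ofReal_mul (mul_nonneg hd0 hlogb0.le)]
  refine le_trans (ENNReal.ofReal_le_ofReal (mul_le_mul_of_nonneg_right ?_ hLk.le))
    (RateDistortion.ofReal_le_rateOn hk hC hcomp hL hM hLtop hC' hν hμ hfreq
      (Real.rpow_pos_of_pos hε0 _) h1 h2 rfl h3 hL₀ hε0 hη0 h5)
  rw [hlogb, mul_div_assoc']
  exact div_le_div_of_nonneg_right h4 hlog2.le
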